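/- Let $d\ge 2$ and let $K\subseteq\mathbf R^d$ be a closed convex set whose affine hull $A_K$ has dimension $k\in\{1,\dots,d-1\}$. Identify $A_K$ isometrically with $\mathbf R^k$ and suppose that the dimension at infinity of $K$, \[ k_\infty=\liminf_{r\to\infty}\frac{\log|K\cap B_r|}{\log r},\qquad B_r=\{y\in\mathbf R^k:|y|<r\}, \] where $|\cdot|$ is the $k$-dimensional Lebesgue measure, satisfies $k_\infty=k$. Let $\Omega=\mathbf R^d\setminus K$, let $d_\Gamma(x)=\inf_{y\in K}|x-y|$ for $x\in\Omega$ be the distance to $\Gamma=\partial\Omega$, let $\delta,\delta'\ge 0$, and let $c_\Omega=c\circ d_\Gamma$ with $c(s)=s^{\delta}(1+s)^{\delta'-\delta}$ for $s>0$. Let $p\in[1,\infty)$ satisfy $d-k+\min(\delta,\delta')-p>0$. Then the optimal constant \[ \mu_p(\Omega)=\inf\left\{\int_\Omega c_\Omega\,|\nabla\varphi|^p\Big/\int_\Omega c_\Omega\,d_\Gamma^{-p}\,|\varphi|^p:\ \varphi\in C_c^1(\Omega),\ \varphi\neq0\right\} \] in the weighted Hardy inequality on $\Omega$, with $\varphi$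 real-valued, is \[ \mu_p(\Omega)=\left(\frac{d-k+\min(\delta,\delta')-p}{p}\right)^p . \] -/

import Mathlib

open MeasureTheory Filter
open scoped ENNReal

noncomputable section

/-- The dimension of a set `K` in `ℝ^d`: the dimension of its affine hull. -/
def affineDim {d : ℕ} (K : Set (EuclideanSpace ℝ (Fin d))) : ℕ :=
  Module.finrank ℝ (affineSpan ℝ K).direction

/-- The dimension at infinity of a set `S` in `ℝ^k`,
`liminf_{r → ∞} log |S ∩ B_r| / log r`, with `|·|` the `k`-dimensional Lebesgue measure and `B_r`
the open ball of radius `r` at the origin. It is computed in the extended reals (`log 0 = -∞`). -/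
def dimAtInfinity {k : ℕ} (S : Set (EuclideanSpace ℝ (Fin k))) : EReal :=
  liminf (fun r : ℝ => ENNReal.log (volume (S ∩ Metric.ball 0 r)) / (Real.log r : EReal)) atTop

/-- The weight function `c(s) = s^δ (1+s)^(δ'-δ)` on `(0,∞)`, which behaves as `s^δ` at the origin
and as `s^δ'` at infinity. -/
def weight (δ δ' s : ℝ) : ℝ := s ^ δ * (1 + s) ^ (δ' - δ)

/-- The Euclidean distance `d_Γ(x) = inf_{y ∉ Ω} |x - y|`, for `x ∈ Ω`, to the boundary of `Ω`. -/
def bdryDist {d : ℕ} (Ω : Set (EuclideanSpace ℝ (Fin d))) (x : EuclideanSpace ℝ (Fin d)) : ℝ :=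
  Metric.infDist x Ωᶜ

/-- The space `C_c^1(Ω)` of real functions; its elements are regarded as functions on `ℝ^d`
vanishing outside `Ω`. -/
def testFunctions {d : ℕ} (Ω : Set (EuclideanSpace ℝ (Fin d))) :
    Set (EuclideanSpace ℝ (Fin d) → ℝ) :=
  {φ | ContDiff ℝ 1 φ ∧ HasCompactSupport φ ∧ tsupport φ ⊆ Ω}

/-- `∫_Ω c_Ω |∇φ|^p` with `c_Ω = c ∘ d_Γ`. -/
def hardyEnergy {d : ℕ} (p δ δ' : ℝ) (Ω : Set (EuclideanSpace ℝ (Fin d)))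
    (φ : EuclideanSpace ℝ (Fin d) → ℝ) : ℝ≥0∞ :=
  ∫⁻ x in Ω, ENNReal.ofReal (weight δ δ' (bdryDist Ω x) * ‖gradient φ x‖ ^ p)

/-- `∫_Ω c_Ω d_Γ^(-p) |φ|^p` with `c_Ω = c ∘ d_Γ`. -/
def hardyMass {d : ℕ} (p δ δ' : ℝ) (Ω : Set (EuclideanSpace ℝ (Fin d)))
    (φ : EuclideanSpace ℝ (Fin d) → ℝ) : ℝ≥0∞ :=
  ∫⁻ x in Ω, ENNReal.ofReal
    (weight δ δ' (bdryDist Ω x) * bdryDist Ω x ^ (-p) * |φ x| ^ p)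

/-- The optimal constant `μ_p(Ω)` of the weighted Hardy inequality: the infimum of the quotients
`∫_Ω c_Ω |∇φ|^p / ∫_Ω c_Ω d_Γ^(-p) |φ|^p` over the nonzero `φ ∈ C_c^1(Ω)`. -/
def hardyConstant {d : ℕ} (p δ δ' : ℝ) (Ω : Set (EuclideanSpace ℝ (Fin d))) : ℝ≥0∞ :=
  ⨅ φ ∈ {φ | φ ∈ testFunctions Ω ∧ φ ≠ 0}, hardyEnergy p δ δ' Ω φ / hardyMass p δ δ' Ω φ

end

/-! Write n = d - k, m = min(δ, δ') and a = (n + m - p)/p; the constant is a^p. The two inequalities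
have independent proofs.

Lower bound. Let P be the nearest-point projection onto K and T_t x = P x + t (x - P x) for t ≥ 1.
Integrating ∇φ along the ray t ↦ T_t x gives |φ(x)| / d_Γ(x) ≤ ∫_1^∞ |∇φ(T_t x)| dt. The map T_t
multiplies d_Γ by t and c_Ω by at least t^m. It expands volume by at least t^n: normal to the affine
hull it is a dilation, and along the hull it does not shrink distances
(`lintegral_comp_homothety_le`). So composition with T_t has norm at most t^(-(n+m)/p) = t^(-(a+1))
on L^p(c_Ω), and Minkowski's integral inequality gives the constant ∫_1^∞ t^(-(a+1)) dt = 1/a. This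
is `hardyMass_le_hardyEnergy`.

Upper bound. Full dimension at infinity forces K to contain arbitrarily large balls of its hull
(`exists_closedBall_subset_of_dimAtInfinity`). Over such a ball d_Γ is just |z|, the length of the
normal component. Test functions are u(y) |z|^(-a) H(log|z| / N), with u a cutoff in a huge ball and
H a cutoff on a logarithmic scale, placed near 0 or near infinity, where c(s) is comparable with
s^m. Both cutoffs perturb the gradient by a relative error O(1/N), so the quotients are at most (a +
C/N)^p (`exists_testFunction_hardyEnergy_le`). -/

/-! ### Projection onto a convex set and the homotheties along its normals. -/

section MetricProjection

variable {F : Type*} [NormedAddCommGroup F] [InnerProductSpace ℝ F]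

/-- `P` maps every point to its nearest point in the convex set `K`, expressed by the variational
inequality. -/
def IsConvexProjection (K : Set F) (P : F → F) : Prop :=
  ∀ x, P x ∈ K ∧ ∀ w ∈ K, inner ℝ (x - P x) (w - P x) ≤ 0

theorem exists_isConvexProjection [CompleteSpace F] {K : Set F} (hne : K.Nonempty)
    (hcl : IsClosed K) (hcv : Convex ℝ K) : ∃ P : F → F, IsConvexProjection K P := by
  have h : ∀ x : F, ∃ v ∈ K, ‖x - v‖ = ⨅ w : K, ‖x - w‖ :=
    fun x => exists_norm_eq_iInf_of_complete_convex hne hcl.isComplete hcv x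
  choose P hPK hP using h
  exact ⟨P, fun x => ⟨hPK x, (norm_eq_iInf_iff_real_inner_le_zero hcv (hPK x)).1 (hP x)⟩⟩

theorem infDist_eq_of_inner_le_zero {K : Set F} {x v : F} (hv : v ∈ K)
    (h : ∀ w ∈ K, inner ℝ (x - v) (w - v) ≤ 0) : Metric.infDist x K = ‖x - v‖ := by
  apply le_antisymm
  · rw [← dist_eq_norm]
    exact Metric.infDist_le_dist_of_mem hv
  · rw [Metric.le_infDist ⟨v, hv⟩]
    intro w hw
    rw [dist_eq_norm]
    have h1 := h w hw
    have h2 : ‖x - w‖ ^ 2 = ‖x - v‖ ^ 2 - 2 * inner ℝ (x - v) (w - v) + ‖w - v‖ ^ 2 := by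
      rw [← norm_sub_sq_real]
      congr 2
      abel
    nlinarith [norm_nonneg (x - v), norm_nonneg (x - w), sq_nonneg ‖w - v‖]

theorem eq_of_inner_le_zero {K : Set F} {x v v' : F} (hv : v ∈ K) (hv' : v' ∈ K)
    (h : ∀ w ∈ K, inner ℝ (x - v) (w - v) ≤ 0) (h' : ∀ w ∈ K, inner ℝ (x - v') (w - v') ≤ 0) :
    v = v' := by
  have h1 := h v' hv'
  have h2 := h' v hv
  have h3 : inner ℝ (x - v) (v' - v) + inner ℝ (x - v') (v - v') = ‖v - v'‖ ^ 2 := by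
    rw [← real_inner_self_eq_norm_sq]
    have : inner ℝ (x - v') (v - v') = - inner ℝ (x - v') (v' - v) := by
      rw [← inner_neg_right, neg_sub]
    rw [this, ← sub_eq_add_neg, ← inner_sub_left, ← neg_sub v v', inner_neg_right,
      ← inner_neg_left]
    congr 1
    abel
  have h4 : ‖v - v'‖ = 0 := by
    have := sq_nonneg ‖v - v'‖
    exact pow_eq_zero_iff (two_ne_zero) |>.1 (by linarith)
  exact sub_eq_zero.1 (norm_eq_zero.1 h4)

namespace IsConvexProjection

variable {K : Set F} {P : F → F}

theorem infDist_eq (hP : IsConvexProjection K P) (x : F) : Metric.infDist x K = ‖x - P x‖ :=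
  infDist_eq_of_inner_le_zero (hP x).1 (hP x).2

theorem eq_of_inner_le_zero (hP : IsConvexProjection K P) {x v : F} (hv : v ∈ K)
    (h : ∀ w ∈ K, inner ℝ (x - v) (w - v) ≤ 0) : P x = v :=
  _root_.eq_of_inner_le_zero (hP x).1 hv (hP x).2 h

/-- Firm nonexpansiveness: add the variational inequality at `x` tested with `P y` to the one at `y`
tested with `P x`. -/
theorem norm_sub_sq_le (hP : IsConvexProjection K P) (x y : F) :
    ‖P x - P y‖ ^ 2 ≤ inner ℝ (P x - P y) (x - y) := by
  have h1 := (hP x).2 _ (hP y).1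
  have h2 := (hP y).2 _ (hP x).1
  rw [← neg_sub (P x) (P y), inner_neg_right] at h1
  have h3 : inner ℝ (P x - P y) (x - y) - ‖P x - P y‖ ^ 2
      = inner ℝ (x - P x) (P x - P y) - inner ℝ (y - P y) (P x - P y) := by
    rw [← real_inner_self_eq_norm_sq, ← inner_sub_right, ← inner_sub_left, real_inner_comm]
    congr 1
    abel
  linarith

theorem lipschitzWith (hP : IsConvexProjection K P) : LipschitzWith 1 P := by
  refine LipschitzWith.of_dist_le_mul fun x y => ?_
  rw [dist_eq_norm, dist_eq_norm, NNReal.coe_one, one_mul]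
  have h := (hP.norm_sub_sq_le x y).trans (real_inner_le_norm _ _)
  by_contra! hlt
  have : 0 < ‖P x - P y‖ := (norm_nonneg _).trans_lt hlt
  nlinarith

theorem continuous (hP : IsConvexProjection K P) : Continuous P := hP.lipschitzWith.continuous

/-- The outward normals at `P x` form a cone, so sliding along the normal ray keeps the same foot.
-/
theorem apply_homothety (hP : IsConvexProjection K P) {t : ℝ} (ht : 0 ≤ t) (x : F) :
    P (P x + t • (x - P x)) = P x := by
  refine hP.eq_of_inner_le_zero (hP x).1 fun w hw => ?_
  rw [add_sub_cancel_left, inner_smul_left]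
  exact mul_nonpos_of_nonneg_of_nonpos ht ((hP x).2 w hw)

theorem infDist_homothety (hP : IsConvexProjection K P) {t : ℝ} (ht : 0 ≤ t) (x : F) :
    Metric.infDist (P x + t • (x - P x)) K = t * Metric.infDist x K := by
  rw [hP.infDist_eq, hP.apply_homothety ht, hP.infDist_eq, add_sub_cancel_left, norm_smul,
    Real.norm_of_nonneg ht]

theorem antilipschitzWith_homothety (hP : IsConvexProjection K P) {t : ℝ} (ht : 1 ≤ t) :
    AntilipschitzWith 1 fun x => P x + t • (x - P x) := by
  refine AntilipschitzWith.of_le_mul_dist fun x y => ?_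
  rw [dist_eq_norm, dist_eq_norm, NNReal.coe_one, one_mul]
  have h1 := hP.norm_sub_sq_le x y
  have h2 := real_inner_le_norm (P x - P y) (x - y)
  have h3 : (P x + t • (x - P x)) - (P y + t • (y - P y))
      = t • (x - y) - (t - 1) • (P x - P y) := by
    module
  have h4 : ‖t • (x - y) - (t - 1) • (P x - P y)‖ ^ 2
      = t ^ 2 * ‖x - y‖ ^ 2 - 2 * (t * (t - 1)) * inner ℝ (P x - P y) (x - y)
        + (t - 1) ^ 2 * ‖P x - P y‖ ^ 2 := by
    rw [norm_sub_sq_real, norm_smul, norm_smul, inner_smul_left, inner_smul_right,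
      real_inner_comm, mul_pow, mul_pow, Real.norm_eq_abs, Real.norm_eq_abs, sq_abs, sq_abs]
    simp only [conj_trivial]
    ring
  have h5 : ‖P x - P y‖ ≤ ‖x - y‖ := by
    simpa [dist_eq_norm] using hP.lipschitzWith.dist_le_mul x y
  rw [h3]
  refine (pow_le_pow_iff_left₀ (norm_nonneg _) (norm_nonneg _) two_ne_zero).1 ?_
  rw [h4]
  have ht' := sub_nonneg.2 ht
  have h6 : ‖P x - P y‖ ^ 2 ≤ ‖x - y‖ ^ 2 := by gcongr
  -- With u = ‖x - y‖ and v = ‖P x - P y‖ ≤ u, Cauchy–Schwarz bounds the difference of the squares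
  -- below by t(t-1)(u-v)² + (t-1)(u²-v²) ≥ 0.
  nlinarith [mul_nonneg (mul_nonneg ht' (zero_le_one.trans ht)) (sub_nonneg.2 h2),
    mul_nonneg (mul_nonneg ht' (zero_le_one.trans ht)) (sq_nonneg (‖x - y‖ - ‖P x - P y‖)),
    mul_nonneg ht' (sub_nonneg.2 h6)]

end IsConvexProjection

end MetricProjection

/-! ### Volume under expanding maps and dilations. -/

section MeasureLemmas

variable {F : Type*} [NormedAddCommGroup F] [InnerProductSpace ℝ F] [FiniteDimensional ℝ F]
  [MeasurableSpace F] [BorelSpace F]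

/-- Lebesgue measure is a multiple of top-dimensional Hausdorff measure, which sees only distances.
Hence no derivative or Jacobian of the projection is ever needed. -/
theorem AntilipschitzWith.volume_preimage_le {f : F → F} (hf : AntilipschitzWith 1 f)
    (s : Set F) : volume (f ⁻¹' s) ≤ volume s := by
  have h := Measure.isAddLeftInvariant_eq_smul (volume : Measure F)
    (Measure.hausdorffMeasure (Module.finrank ℝ F))
  rw [h, Measure.smul_apply, Measure.smul_apply]
  have := hf.hausdorffMeasure_preimage_le (Nat.cast_nonneg (Module.finrank ℝ F)) s
  simp only [ENNReal.coe_one, ENNReal.one_rpow, one_mul] at this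
  exact smul_le_smul_of_nonneg_left this zero_le

theorem AntilipschitzWith.lintegral_comp_le {f : F → F} (hf : AntilipschitzWith 1 f)
    (hfm : Measurable f) {G : F → ℝ≥0∞} (hG : Measurable G) :
    ∫⁻ x, G (f x) ≤ ∫⁻ x, G x := by
  rw [← lintegral_map hG hfm]
  refine lintegral_mono' (Measure.le_iff.2 fun s hs => ?_) le_rfl
  rw [Measure.map_apply hfm hs]
  exact hf.volume_preimage_le s

theorem lintegral_comp_smul_eq {t : ℝ} (ht : 0 < t) {G : F → ℝ≥0∞} (hG : Measurable G) :
    ∫⁻ x : F, G (t • x) = ENNReal.ofReal (t ^ (-(Module.finrank ℝ F : ℝ))) * ∫⁻ x, G x := by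
  rw [← lintegral_map hG (measurable_const_smul t), Measure.map_addHaar_smul volume ht.ne',
    lintegral_smul_measure, smul_eq_mul, abs_of_pos (by positivity), Real.rpow_neg ht.le,
    Real.rpow_natCast]

end MeasureLemmas

/-! ### Coordinates tangential and normal to the affine hull. -/

section OrthogonalCoordinates

variable {Y Z E : Type*} [NormedAddCommGroup Y] [InnerProductSpace ℝ Y]
  [NormedAddCommGroup Z] [InnerProductSpace ℝ Z] [NormedAddCommGroup E] [InnerProductSpace ℝ E]

/-- The isometry `(y, z) ↦ A y + B z` for isometries with orthogonal ranges. -/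
noncomputable def orthogonalSum (A : Y →ₗᵢ[ℝ] E) (B : Z →ₗᵢ[ℝ] E)
    (hAB : ∀ y z, inner ℝ (A y) (B z) = 0) : WithLp 2 (Y × Z) →ₗᵢ[ℝ] E where
  toLinearMap := (A.toLinearMap.coprod B.toLinearMap) ∘ₗ
    (WithLp.linearEquiv 2 ℝ (Y × Z)).toLinearMap
  norm_map' w := by
    have h1 : ‖A w.fst + B w.snd‖ ^ 2 = ‖w‖ ^ 2 := by
      rw [norm_add_sq_real, hAB, A.norm_map, B.norm_map, WithLp.prod_norm_sq_eq_of_L2]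
      ring
    exact (pow_left_inj₀ (norm_nonneg _) (norm_nonneg _) two_ne_zero).1 h1

theorem orthogonalSum_apply (A : Y →ₗᵢ[ℝ] E) (B : Z →ₗᵢ[ℝ] E)
    (hAB : ∀ y z, inner ℝ (A y) (B z) = 0) (w : WithLp 2 (Y × Z)) :
    orthogonalSum A B hAB w = A w.fst + B w.snd := rfl

variable [FiniteDimensional ℝ Z] [FiniteDimensional ℝ E]

/-- An isometric embedding of a space of the complementary dimension onto the orthogonal complement
of the range of a given one. -/
theorem exists_orthogonal_linearIsometry (A : Y →ₗᵢ[ℝ] E)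
    (h : Module.finrank ℝ Y + Module.finrank ℝ Z = Module.finrank ℝ E) :
    ∃ B : Z →ₗᵢ[ℝ] E, ∀ y z, inner ℝ (A y) (B z) = 0 := by
  let W : Submodule ℝ E := (LinearMap.range A.toLinearMap)ᗮ
  have h1 : Module.finrank ℝ (LinearMap.range A.toLinearMap) = Module.finrank ℝ Y :=
    LinearMap.finrank_range_of_inj A.injective
  have h2 := Submodule.finrank_add_finrank_orthogonal (LinearMap.range A.toLinearMap)
  have h3 : Module.finrank ℝ Z = Module.finrank ℝ W := by
    simp only [W]
    omega
  let g : Z ≃ₗᵢ[ℝ] W := (stdOrthonormalBasis ℝ Z).repr.trans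
    ((stdOrthonormalBasis ℝ W).reindex (finCongr h3.symm)).repr.symm
  refine ⟨W.subtypeₗᵢ.comp g.toLinearIsometry, fun y z => ?_⟩
  exact (Submodule.mem_orthogonal _ _).1 (g z).2 (A y) ⟨y, rfl⟩

variable [FiniteDimensional ℝ Y]

theorem exists_eq_orthogonal_add {A : Y →ₗᵢ[ℝ] E} {B : Z →ₗᵢ[ℝ] E}
    (hAB : ∀ y z, inner ℝ (A y) (B z) = 0)
    (h : Module.finrank ℝ Y + Module.finrank ℝ Z = Module.finrank ℝ E) (b x : E) :
    ∃ y z, x = b + (A y + B z) := by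
  have hf : Module.finrank ℝ (WithLp 2 (Y × Z)) = Module.finrank ℝ E := by
    rw [(WithLp.linearEquiv 2 ℝ (Y × Z)).finrank_eq, Module.finrank_prod, h]
  obtain ⟨w, hw⟩ := ((orthogonalSum A B hAB).toLinearIsometryEquiv hf).surjective (x - b)
  refine ⟨w.fst, w.snd, ?_⟩
  rw [← orthogonalSum_apply A B hAB, ← LinearIsometry.coe_toLinearIsometryEquiv _ hf, hw]
  abel

variable [MeasurableSpace Y] [BorelSpace Y] [MeasurableSpace Z] [BorelSpace Z]
  [MeasurableSpace E] [BorelSpace E]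

theorem measurePreserving_orthogonal_add {A : Y →ₗᵢ[ℝ] E} {B : Z →ₗᵢ[ℝ] E}
    (hAB : ∀ y z, inner ℝ (A y) (B z) = 0)
    (h : Module.finrank ℝ Y + Module.finrank ℝ Z = Module.finrank ℝ E) (b : E) :
    MeasurePreserving (fun q : Y × Z => b + (A q.1 + B q.2)) := by
  have hf : Module.finrank ℝ (WithLp 2 (Y × Z)) = Module.finrank ℝ E := by
    rw [(WithLp.linearEquiv 2 ℝ (Y × Z)).finrank_eq, Module.finrank_prod, h]
  have h1 := ((orthogonalSum A B hAB).toLinearIsometryEquiv hf).measurePreserving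
  have h2 := WithLp.volume_preserving_toLp Y Z
  exact (measurePreserving_add_left volume b).comp (h1.comp h2)

theorem lintegral_orthogonal_add {A : Y →ₗᵢ[ℝ] E} {B : Z →ₗᵢ[ℝ] E}
    (hAB : ∀ y z, inner ℝ (A y) (B z) = 0)
    (h : Module.finrank ℝ Y + Module.finrank ℝ Z = Module.finrank ℝ E) (b : E)
    {G : E → ℝ≥0∞} (hG : Measurable G) :
    ∫⁻ x, G x = ∫⁻ y : Y, ∫⁻ z : Z, G (b + (A y + B z)) := by
  have hm := measurePreserving_orthogonal_add hAB h b
  rw [← hm.lintegral_comp hG, Measure.volume_eq_prod,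
    lintegral_prod (fun q : Y × Z => G (b + (A q.1 + B q.2)))
      (hG.comp hm.measurable).aemeasurable]

/-- The homothety `x ↦ P x + t (x - P x)`, `t ≥ 1`, with respect to a convex set `K` contained in an
affine subspace of codimension `n` expands the volume by a factor at least `t ^ n`. -/
theorem lintegral_comp_homothety_le {A : Y →ₗᵢ[ℝ] E} {B : Z →ₗᵢ[ℝ] E}
    (hAB : ∀ y z, inner ℝ (A y) (B z) = 0)
    (h : Module.finrank ℝ Y + Module.finrank ℝ Z = Module.finrank ℝ E) (b : E)
    {K : Set E} (hK : ∀ x ∈ K, ∃ y, x = b + A y) {Q : Y → Y}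
    (hQ : IsConvexProjection {y | b + A y ∈ K} Q) {P : E → E} (hP : IsConvexProjection K P)
    {t : ℝ} (ht : 1 ≤ t) {G : E → ℝ≥0∞} (hG : Measurable G) :
    ∫⁻ x, G (P x + t • (x - P x)) ≤
      ENNReal.ofReal (t ^ (-(Module.finrank ℝ Z : ℝ))) * ∫⁻ x, G x := by
  have ht0 : 0 < t := zero_lt_one.trans_le ht
  -- The normal component `B z` is orthogonal to all directions inside `K`, so projecting onto `K`
  -- amounts to projecting `y` inside the hull.
  have hproj : ∀ y z, P (b + (A y + B z)) = b + A (Q y) := by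
    intro y z
    refine hP.eq_of_inner_le_zero (hQ y).1 fun w hw => ?_
    obtain ⟨y', rfl⟩ := hK w hw
    have h1 : b + (A y + B z) - (b + A (Q y)) = A (y - Q y) + B z := by
      rw [map_sub]; abel
    have h2 : b + A y' - (b + A (Q y)) = A (y' - Q y) := by
      rw [map_sub]; abel
    rw [h1, h2, inner_add_left, A.inner_map_map, real_inner_comm (A _) (B _), hAB, add_zero]
    exact (hQ y).2 y' hw
  have hm : Measurable fun x => G (P x + t • (x - P x)) := by
    refine hG.comp (Continuous.measurable ?_)
    have := hP.continuous
    fun_prop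
  have hmap : ∀ y z, P (b + (A y + B z)) + t • (b + (A y + B z) - P (b + (A y + B z)))
      = b + (A (Q y + t • (y - Q y)) + B (t • z)) := by
    intro y z
    rw [hproj]
    simp only [map_add, map_smul, map_sub]
    module
  have hGm : ∀ y, Measurable fun z => G (b + (A y + B z)) := fun y => by
    refine hG.comp (Continuous.measurable ?_)
    have := B.continuous
    fun_prop
  have hm2 : Measurable fun y => ∫⁻ z, G (b + (A y + B z)) := by
    exact Measurable.lintegral_prod_right'
      (hG.comp (measurePreserving_orthogonal_add hAB h b).measurable)
  rw [lintegral_orthogonal_add hAB h b hm, lintegral_orthogonal_add hAB h b hG]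
  simp_rw [hmap]
  -- The dilation in `z` yields the power of `t` exactly; the homothety in `y` is only known not to
  -- decrease volume, whence the inequality.
  calc ∫⁻ y, ∫⁻ z, G (b + (A (Q y + t • (y - Q y)) + B (t • z)))
      = ∫⁻ y, ENNReal.ofReal (t ^ (-(Module.finrank ℝ Z : ℝ))) *
          ∫⁻ z, G (b + (A (Q y + t • (y - Q y)) + B z)) := by
        refine lintegral_congr fun y => ?_
        exact lintegral_comp_smul_eq ht0 (hGm (Q y + t • (y - Q y)))
    _ = ENNReal.ofReal (t ^ (-(Module.finrank ℝ Z : ℝ))) *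
          ∫⁻ y, ∫⁻ z, G (b + (A (Q y + t • (y - Q y)) + B z)) :=
        lintegral_const_mul' _ _ ENNReal.ofReal_ne_top
    _ ≤ _ := by
        gcongr 1
        refine (hQ.antilipschitzWith_homothety ht).lintegral_comp_le ?_ hm2
        have := hQ.continuous
        exact Continuous.measurable (by fun_prop)

end OrthogonalCoordinates

/-! ### Minkowski's integral inequality with a power decay. -/

section MinkowskiIntegral

/-- Minkowski's integral inequality along a family of maps whose weighted `L^p` operator norms decay
like `t ^ (-q)`. -/
theorem lintegral_rpow_lintegral_Ioi_le {X : Type*} [MeasurableSpace X] {μ : Measure X} [SFinite μ]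
    {p q : ℝ} (hp : 1 ≤ p) (hq : 1 < q) {c : X → ℝ≥0∞} (hc : Measurable c)
    {g : ℝ → X → ℝ≥0∞} (hg : Measurable (Function.uncurry g)) {M : ℝ≥0∞}
    (hM : ∀ t, 1 < t → ∫⁻ x, c x * g t x ^ p ∂μ ≤ ENNReal.ofReal (t ^ (-(p * q))) * M) :
    ∫⁻ x, c x * (∫⁻ t in Set.Ioi 1, g t x) ^ p ∂μ ≤ ENNReal.ofReal ((q - 1)⁻¹ ^ p) * M := by
  have hp0 : 0 < p := zero_lt_one.trans_le hp
  set I : ℝ≥0∞ := ENNReal.ofReal (q - 1)⁻¹ with hI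
  have hw : ∫⁻ t in Set.Ioi (1 : ℝ), ENNReal.ofReal (t ^ (-q)) = I := by
    rw [← ofReal_integral_eq_lintegral_ofReal
      (integrableOn_Ioi_rpow_of_lt (by linarith) zero_lt_one)
      ((ae_restrict_iff' measurableSet_Ioi).2 (ae_of_all _ fun t ht =>
        Real.rpow_nonneg (zero_le_one.trans (le_of_lt ht)) _)),
      integral_Ioi_rpow_of_lt (by linarith) zero_lt_one, hI, Real.one_rpow]
    congr 1
    rw [← neg_div_neg_eq, neg_neg, one_div]
    congr 1
    ring
  -- Hölder for the finite measure w(t) dt of mass I = 1/(q-1) costs I^(p-1) and leaves the factor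
  -- w^(1-p). After Tonelli the decay hypothesis supplies w^p, so that w remains and contributes the
  -- last factor I.
  set w : ℝ → ℝ≥0∞ := fun t => ENNReal.ofReal (t ^ (-q)) with hwdef
  have hwm : Measurable w := by fun_prop
  have hw0 : ∀ t ∈ Set.Ioi (1 : ℝ), w t ≠ 0 := fun t ht => by
    have : 0 < t ^ (-q) := Real.rpow_pos_of_pos (zero_lt_one.trans ht) _
    simpa [hwdef] using this
  have hwt : ∀ t, w t ≠ ∞ := fun t => ENNReal.ofReal_ne_top
  have hgx : ∀ x, Measurable fun t => g t x := fun x =>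
    hg.comp (measurable_id.prodMk measurable_const)
  have key : ∀ x, (∫⁻ t in Set.Ioi 1, g t x) ^ p ≤
      I ^ (p - 1) * ∫⁻ t in Set.Ioi 1, w t ^ (1 - p) * g t x ^ p := by
    intro x
    set ν : Measure ℝ := (volume.restrict (Set.Ioi 1)).withDensity w with hν
    have hνu : ν Set.univ = I := by
      rw [hν, withDensity_apply _ MeasurableSet.univ, Measure.restrict_univ, hw]
    have h1 : ∫⁻ t in Set.Ioi 1, g t x = ∫⁻ t, g t x / w t ∂ν := by
      rw [hν, lintegral_withDensity_eq_lintegral_mul _ hwm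
        (g := fun t => g t x / w t) ((hgx x).div hwm)]
      refine setLIntegral_congr_fun measurableSet_Ioi fun t ht => ?_
      simp only [Pi.mul_apply]
      rw [ENNReal.mul_div_cancel (hw0 t ht) (hwt t)]
    have h2 : ∫⁻ t in Set.Ioi 1, w t ^ (1 - p) * g t x ^ p = ∫⁻ t, (g t x / w t) ^ p ∂ν := by
      rw [hν, lintegral_withDensity_eq_lintegral_mul _ hwm
        (g := fun t => (g t x / w t) ^ p) (((hgx x).div hwm).pow_const p)]
      refine setLIntegral_congr_fun measurableSet_Ioi fun t ht => ?_
      simp only [Pi.mul_apply]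
      rw [ENNReal.div_rpow_of_nonneg _ _ hp0.le, ENNReal.rpow_sub _ _ (hw0 t ht) (hwt t),
        ENNReal.rpow_one, div_eq_mul_inv, div_eq_mul_inv]
      ring
    have h3 := eLpNorm'_le_eLpNorm'_mul_rpow_measure_univ (μ := ν) (f := fun t => g t x / w t)
      zero_lt_one hp ((hgx x).div hwm).aestronglyMeasurable
    simp only [eLpNorm', enorm_eq_self, ENNReal.rpow_one, div_one, hνu] at h3
    rw [h1, h2]
    calc (∫⁻ t, g t x / w t ∂ν) ^ p
        ≤ ((∫⁻ t, (g t x / w t) ^ p ∂ν) ^ (1 / p) * I ^ (1 - 1 / p)) ^ p := by gcongr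
      _ = I ^ (p - 1) * ∫⁻ t, (g t x / w t) ^ p ∂ν := by
        rw [ENNReal.mul_rpow_of_nonneg _ _ hp0.le, ← ENNReal.rpow_mul, ← ENNReal.rpow_mul,
          one_div, inv_mul_cancel₀ hp0.ne', ENNReal.rpow_one, sub_mul, one_mul,
          inv_mul_cancel₀ hp0.ne', mul_comm]
  have hItop : I ^ (p - 1) ≠ ∞ := ENNReal.rpow_ne_top_of_nonneg (by linarith) ENNReal.ofReal_ne_top
  have hmeas : Measurable (Function.uncurry fun (x : X) (t : ℝ) =>
      c x * (w t ^ (1 - p) * g t x ^ p)) := by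
    have h1 : Measurable fun z : X × ℝ => g z.2 z.1 := hg.comp measurable_swap
    exact (hc.comp measurable_fst).mul
      (((hwm.comp measurable_snd).pow_const _).mul (h1.pow_const _))
  calc ∫⁻ x, c x * (∫⁻ t in Set.Ioi 1, g t x) ^ p ∂μ
      ≤ ∫⁻ x, I ^ (p - 1) * (∫⁻ t in Set.Ioi 1, c x * (w t ^ (1 - p) * g t x ^ p)) ∂μ := by
        refine lintegral_mono fun x => ?_
        rw [lintegral_const_mul _ (f := fun t => w t ^ (1 - p) * g t x ^ p)
          ((hwm.pow_const _).mul ((hgx x).pow_const _))]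
        calc c x * (∫⁻ t in Set.Ioi 1, g t x) ^ p
            ≤ c x * (I ^ (p - 1) * ∫⁻ t in Set.Ioi 1, w t ^ (1 - p) * g t x ^ p) := by
              gcongr
              exact key x
          _ = _ := by ring
    _ = I ^ (p - 1) * ∫⁻ t in Set.Ioi 1, ∫⁻ x, c x * (w t ^ (1 - p) * g t x ^ p) ∂μ := by
        rw [lintegral_const_mul' _ _ hItop, lintegral_lintegral_swap hmeas.aemeasurable]
    _ ≤ I ^ (p - 1) * ∫⁻ t in Set.Ioi 1, w t * M := by
        gcongr 1
        refine setLIntegral_mono (hwm.mul_const _) fun t ht => ?_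
        have ht0 : 0 < t := zero_lt_one.trans ht
        have htop : w t ^ (1 - p) ≠ ∞ := ENNReal.rpow_ne_top_of_ne_zero (hw0 t ht) (hwt t)
        calc ∫⁻ x, c x * (w t ^ (1 - p) * g t x ^ p) ∂μ
            = w t ^ (1 - p) * ∫⁻ x, c x * g t x ^ p ∂μ := by
              rw [← lintegral_const_mul' _ _ htop]
              refine lintegral_congr fun x => ?_
              ring
          _ ≤ w t ^ (1 - p) * (ENNReal.ofReal (t ^ (-(p * q))) * M) := by
              gcongr
              exact hM t ht
          _ = w t * M := by
              have : ENNReal.ofReal (t ^ (-(p * q))) = w t ^ p := by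
                rw [hwdef, ENNReal.ofReal_rpow_of_pos (Real.rpow_pos_of_pos ht0 _),
                  ← Real.rpow_mul ht0.le]
                congr 2
                ring
              rw [this, ← mul_assoc, ← ENNReal.rpow_add _ _ (hw0 t ht) (hwt t)]
              simp
    _ = ENNReal.ofReal ((q - 1)⁻¹ ^ p) * M := by
        rw [lintegral_mul_const _ hwm, hw, ← mul_assoc, ← ENNReal.ofReal_rpow_of_nonneg
          (inv_nonneg.2 (by linarith)) hp0.le]
        have hI0 : I ≠ 0 := by
          have : 0 < (q - 1)⁻¹ := inv_pos.2 (by linarith)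
          simpa [hI] using hq
        nth_rw 2 [← ENNReal.rpow_one I]
        rw [← ENNReal.rpow_add _ _ hI0 ENNReal.ofReal_ne_top, sub_add_cancel]

end MinkowskiIntegral

/-! ### Growth of the weight under dilation. -/

section Weight

theorem weight_nonneg (δ δ' : ℝ) {s : ℝ} (hs : 0 ≤ s) : 0 ≤ weight δ δ' s := by
  unfold weight
  positivity

theorem weight_pos (δ δ' : ℝ) {s : ℝ} (hs : 0 < s) : 0 < weight δ δ' s := by
  unfold weight
  positivity

theorem measurable_weight (δ δ' : ℝ) : Measurable (weight δ δ') := by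
  unfold weight
  fun_prop

theorem continuousAt_weight (δ δ' : ℝ) {s : ℝ} (hs : 0 < s) : ContinuousAt (weight δ δ') s := by
  unfold weight
  refine (Real.continuousAt_rpow_const _ _ (Or.inl hs.ne')).mul ?_
  exact (continuousAt_const.add continuousAt_id).rpow_const (Or.inl (by simp; positivity))

/-- The logarithmic derivative s c'(s)/c(s) lies between δ and δ'. Concretely, 1 + s ≤ 1 + ts ≤ t(1
+ s), and the sign of δ' - δ decides which side is needed. -/
theorem rpow_min_mul_weight_le (δ δ' : ℝ) {s t : ℝ} (hs : 0 < s) (ht : 1 ≤ t) :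
    t ^ min δ δ' * weight δ δ' s ≤ weight δ δ' (t * s) := by
  have ht0 : 0 < t := zero_lt_one.trans_le ht
  unfold weight
  rw [Real.mul_rpow ht0.le hs.le]
  rcases le_total δ δ' with h | h
  · rw [min_eq_left h, mul_assoc]
    gcongr
    nlinarith
  · rw [min_eq_right h]
    have h1 : (t * (1 + s)) ^ (δ' - δ) ≤ (1 + t * s) ^ (δ' - δ) :=
      Real.rpow_le_rpow_of_nonpos (by positivity) (by nlinarith) (by linarith)
    rw [Real.mul_rpow ht0.le (by positivity)] at h1
    calc t ^ δ' * (s ^ δ * (1 + s) ^ (δ' - δ))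
        = t ^ δ * s ^ δ * (t ^ (δ' - δ) * (1 + s) ^ (δ' - δ)) := by
          rw [show δ' = δ + (δ' - δ) by ring, Real.rpow_add ht0]
          ring_nf
      _ ≤ _ := by gcongr

end Weight

/-! ### The fundamental theorem of calculus along rays. -/

section RayEstimate

variable {E : Type*} [NormedAddCommGroup E] [NormedSpace ℝ E]

theorem hasCompactSupport_comp_ray {φ : E → ℝ} (hφ : HasCompactSupport φ) (v : E) {N : E}
    (hN : N ≠ 0) : HasCompactSupport fun t : ℝ => φ (v + t • N) := by
  obtain ⟨r, hr⟩ := hφ.isCompact.isBounded.subset_closedBall (0 : E)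
  have hN0 : 0 < ‖N‖ := norm_pos_iff.2 hN
  refine HasCompactSupport.intro (isCompact_closedBall (0 : ℝ) ((r + ‖v‖) / ‖N‖)) fun t ht => ?_
  by_contra hne
  have h1 := hr (subset_tsupport _ hne)
  rw [mem_closedBall_zero_iff] at h1
  refine ht (mem_closedBall_zero_iff.2 ?_)
  rw [le_div_iff₀ hN0, ← norm_smul]
  calc ‖t • N‖ = ‖(v + t • N) - v‖ := by rw [add_sub_cancel_left]
    _ ≤ ‖v + t • N‖ + ‖v‖ := norm_sub_le _ _
    _ ≤ r + ‖v‖ := by gcongr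

/-- A compactly supported function is controlled by its derivative along a ray. -/
theorem enorm_le_lintegral_fderiv_ray {φ : E → ℝ} (hφ : ContDiff ℝ 1 φ)
    (hφc : HasCompactSupport φ) (v : E) {N : E} (hN : N ≠ 0) :
    ‖φ (v + N)‖ₑ ≤ ‖N‖ₑ * ∫⁻ t in Set.Ioi (1 : ℝ), ‖fderiv ℝ φ (v + t • N)‖ₑ := by
  have h1 : ContDiff ℝ 1 fun t : ℝ => φ (v + t • N) := by fun_prop
  have h2 := (hasCompactSupport_comp_ray hφc v hN).integral_Ioi_deriv_eq h1 1
  have h3 : ∀ t : ℝ, deriv (fun t : ℝ => φ (v + t • N)) t = fderiv ℝ φ (v + t • N) N := by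
    intro t
    have h4 : HasDerivAt (fun t : ℝ => v + t • N) N t := by
      simpa using ((hasDerivAt_id t).smul_const N).const_add v
    exact ((hφ.differentiable one_ne_zero _).hasFDerivAt.comp_hasDerivAt t h4).deriv
  rw [one_smul] at h2
  calc ‖φ (v + N)‖ₑ = ‖∫ t in Set.Ioi (1 : ℝ), deriv (fun t : ℝ => φ (v + t • N)) t‖ₑ := by
        rw [h2, enorm_neg]
    _ ≤ ∫⁻ t in Set.Ioi (1 : ℝ), ‖deriv (fun t : ℝ => φ (v + t • N)) t‖ₑ :=
        enorm_integral_le_lintegral_enorm _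
    _ ≤ ∫⁻ t in Set.Ioi (1 : ℝ), ‖N‖ₑ * ‖fderiv ℝ φ (v + t • N)‖ₑ := by
        refine lintegral_mono fun t => ?_
        simp only [h3]
        rw [mul_comm]
        exact ContinuousLinearMap.le_opENorm _ _
    _ = _ := lintegral_const_mul' _ _ enorm_ne_top

end RayEstimate

/-! ### The denominator of the Hardy quotient is finite and nonzero. -/

section Functionals

variable {d : ℕ} {K : Set (EuclideanSpace ℝ (Fin d))}

theorem bdryDist_compl (K : Set (EuclideanSpace ℝ (Fin d))) (x : EuclideanSpace ℝ (Fin d)) :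
    bdryDist Kᶜ x = Metric.infDist x K := by
  rw [bdryDist, compl_compl]

theorem norm_gradient_eq_norm_fderiv (φ : EuclideanSpace ℝ (Fin d) → ℝ)
    (x : EuclideanSpace ℝ (Fin d)) : ‖gradient φ x‖ = ‖fderiv ℝ φ x‖ :=
  LinearIsometryEquiv.norm_map _ _

/-- The compact support stays away from `K`, so the integrand is bounded there. Finiteness lets the
extended quotient be cleared of its denominator. -/
theorem hardyMass_ne_top {p δ δ' : ℝ} (hp : 1 ≤ p) (hK : IsClosed K) (hne : K.Nonempty)
    {φ : EuclideanSpace ℝ (Fin d) → ℝ} (hφ : φ ∈ testFunctions Kᶜ) :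
    hardyMass p δ δ' Kᶜ φ ≠ ∞ := by
  obtain ⟨hφ1, hφc, hφs⟩ := hφ
  have hcont : ContinuousOn (fun x => weight δ δ' (bdryDist Kᶜ x) * bdryDist Kᶜ x ^ (-p) *
      |φ x| ^ p) (tsupport φ) := by
    intro x hx
    have hd : 0 < bdryDist Kᶜ x := by
      rw [bdryDist_compl]
      exact (hK.notMem_iff_infDist_pos hne).1 (hφs hx)
    have hdc : ContinuousAt (bdryDist Kᶜ) x := by
      exact (Metric.continuous_infDist_pt _).continuousAt
    refine ContinuousAt.continuousWithinAt ?_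
    refine (((continuousAt_weight δ δ' hd).comp hdc).mul (hdc.rpow_const (Or.inl hd.ne'))).mul ?_
    exact hφ1.continuous.continuousAt.abs.rpow_const (Or.inr (zero_le_one.trans hp))
  obtain ⟨C, hC⟩ := hφc.isCompact.bddAbove_image hcont
  have hle : hardyMass p δ δ' Kᶜ φ ≤ ∫⁻ _ in tsupport φ, ENNReal.ofReal C := by
    unfold hardyMass
    rw [← lintegral_indicator (isClosed_tsupport φ).measurableSet]
    refine (setLIntegral_le_lintegral _ _).trans (lintegral_mono fun x => ?_)
    by_cases hx : x ∈ tsupport φ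
    · rw [Set.indicator_of_mem hx]
      exact ENNReal.ofReal_le_ofReal (hC ⟨x, hx, rfl⟩)
    · rw [image_eq_zero_of_notMem_tsupport hx, abs_zero,
        Real.zero_rpow (zero_lt_one.trans_le hp).ne']
      simp
  refine (hle.trans_lt ?_).ne
  rw [setLIntegral_const]
  exact ENNReal.mul_lt_top ENNReal.ofReal_lt_top hφc.isCompact.measure_lt_top

theorem hardyMass_ne_zero {p δ δ' : ℝ} (hK : IsClosed K) (hne : K.Nonempty)
    {φ : EuclideanSpace ℝ (Fin d) → ℝ} (hφ : φ ∈ testFunctions Kᶜ) (hφ0 : φ ≠ 0) :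
    hardyMass p δ δ' Kᶜ φ ≠ 0 := by
  obtain ⟨hφ1, hφc, hφs⟩ := hφ
  have hcont := hφ1.continuous
  intro h0
  have hmeas : Measurable fun x => ENNReal.ofReal
      (weight δ δ' (bdryDist Kᶜ x) * bdryDist Kᶜ x ^ (-p) * |φ x| ^ p) := by
    have h1 : Measurable (bdryDist Kᶜ) := (Metric.continuous_infDist_pt _).measurable
    have h2 := hφ1.continuous.measurable
    have h3 := (measurable_weight δ δ').comp h1
    exact ((h3.mul (h1.pow_const _)).mul (h2.abs.pow_const _)).ennreal_ofReal
  unfold hardyMass at h0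
  rw [lintegral_eq_zero_iff hmeas, Filter.EventuallyEq,
    ae_restrict_iff' hK.isOpen_compl.measurableSet] at h0
  have hU : IsOpen (Function.support φ) := hcont.isOpen_support
  have hUne : (Function.support φ).Nonempty := Function.support_nonempty_iff.2 hφ0
  refine (hU.measure_pos volume hUne).ne' (measure_mono_null (fun x hx => ?_) (ae_iff.1 h0))
  have hxK : x ∈ Kᶜ := hφs (subset_tsupport _ hx)
  have hd : 0 < bdryDist Kᶜ x := by
    rw [bdryDist_compl]
    exact (hK.notMem_iff_infDist_pos hne).1 hxK
  have hφx : 0 < |φ x| := abs_pos.2 hx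
  have hw := weight_pos δ δ' hd
  have : 0 < weight δ δ' (bdryDist Kᶜ x) * bdryDist Kᶜ x ^ (-p) * |φ x| ^ p := by positivity
  simp only [Set.mem_ofPred_eq, not_forall]
  exact ⟨hxK, by simpa using this⟩

end Functionals

/-! ### The lower bound. -/

section HardyInequality

variable {d : ℕ} {K : Set (EuclideanSpace ℝ (Fin d))} {Y Z : Type*}
  [NormedAddCommGroup Y] [InnerProductSpace ℝ Y] [FiniteDimensional ℝ Y]
  [MeasurableSpace Y] [BorelSpace Y]
  [NormedAddCommGroup Z] [InnerProductSpace ℝ Z] [FiniteDimensional ℝ Z]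
  [MeasurableSpace Z] [BorelSpace Z]

/-- The weighted Hardy inequality on the complement of a closed convex set `K` contained in the
affine subspace `b + A Y` of codimension `dim Z`. -/
theorem hardyMass_le_hardyEnergy {p δ δ' : ℝ} (hp : 1 ≤ p)
    (hpos : 0 < Module.finrank ℝ Z + min δ δ' - p)
    {A : Y →ₗᵢ[ℝ] EuclideanSpace ℝ (Fin d)} {B : Z →ₗᵢ[ℝ] EuclideanSpace ℝ (Fin d)}
    (hAB : ∀ y z, inner ℝ (A y) (B z) = 0)
    (hdim : Module.finrank ℝ Y + Module.finrank ℝ Z = d) (b : EuclideanSpace ℝ (Fin d))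
    (hKcl : IsClosed K) (hKcv : Convex ℝ K) (hne : K.Nonempty)
    (hK : ∀ x ∈ K, ∃ y, x = b + A y)
    {φ : EuclideanSpace ℝ (Fin d) → ℝ} (hφ : φ ∈ testFunctions Kᶜ) :
    ENNReal.ofReal (((Module.finrank ℝ Z + min δ δ' - p) / p) ^ p) * hardyMass p δ δ' Kᶜ φ
      ≤ hardyEnergy p δ δ' Kᶜ φ := by
  obtain ⟨hφ1, hφc, hφs⟩ := hφ
  have hp0 : 0 < p := zero_lt_one.trans_le hp
  set n : ℝ := (Module.finrank ℝ Z : ℝ) with hn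
  set m := min δ δ' with hm
  set a := (n + m - p) / p with ha
  have ha0 : 0 < a := div_pos hpos hp0
  have hdim' : Module.finrank ℝ Y + Module.finrank ℝ Z
      = Module.finrank ℝ (EuclideanSpace ℝ (Fin d)) := by simpa using hdim
  obtain ⟨P, hP⟩ := exists_isConvexProjection hne hKcl hKcv
  obtain ⟨Q, hQ⟩ : ∃ Q, IsConvexProjection {y | b + A y ∈ K} Q := by
    refine exists_isConvexProjection ?_ ?_ ?_
    · obtain ⟨x, hx⟩ := hne
      obtain ⟨y, rfl⟩ := hK x hx
      exact ⟨y, hx⟩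
    · exact hKcl.preimage (by have := A.continuous; fun_prop)
    · exact (hKcv.translate_preimage_right b).linear_preimage A.toLinearMap
  have hPc := hP.continuous
  have hd0 : ∀ x ∈ Kᶜ, 0 < Metric.infDist x K := fun x hx =>
    (hKcl.notMem_iff_infDist_pos hne).1 hx
  have hfd : Continuous (fderiv ℝ φ) := hφ1.continuous_fderiv one_ne_zero
  have hdm : Measurable fun x : EuclideanSpace ℝ (Fin d) => Metric.infDist x K :=
    (Metric.continuous_infDist_pt _).measurable
  have hwm := (measurable_weight δ δ').comp hdm
  have hKm : MeasurableSet Kᶜ := hKcl.isOpen_compl.measurableSet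
  let c : EuclideanSpace ℝ (Fin d) → ℝ≥0∞ :=
    Kᶜ.indicator fun x => ENNReal.ofReal (weight δ δ' (Metric.infDist x K))
  have hc : Measurable c := hwm.ennreal_ofReal.indicator hKm
  let g : ℝ → EuclideanSpace ℝ (Fin d) → ℝ≥0∞ := fun t x => ‖fderiv ℝ φ (P x + t • (x - P x))‖ₑ
  have hg : Measurable (Function.uncurry g) := by
    refine Continuous.measurable ?_
    simp only [Function.uncurry_def, g]
    fun_prop
  let G : EuclideanSpace ℝ (Fin d) → ℝ≥0∞ := Kᶜ.indicator fun x =>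
    ENNReal.ofReal (weight δ δ' (Metric.infDist x K) * ‖fderiv ℝ φ x‖ ^ p)
  have hG : Measurable G := by
    refine Measurable.indicator ?_ hKm
    exact (hwm.mul (hfd.norm.measurable.pow_const _)).ennreal_ofReal
  have hGE : ∫⁻ x, G x = hardyEnergy p δ δ' Kᶜ φ := by
    rw [lintegral_indicator hKm]
    unfold hardyEnergy
    simp_rw [bdryDist_compl, norm_gradient_eq_norm_fderiv]
  -- The exponent `p * (a + 1)` equals n + m: n comes from the volume expansion and m from the
  -- growth of the weight.
  have hM : ∀ t : ℝ, 1 < t → ∫⁻ x, c x * g t x ^ p ≤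
      ENNReal.ofReal (t ^ (-(p * (a + 1)))) * hardyEnergy p δ δ' Kᶜ φ := by
    intro t ht
    have ht0 : 0 < t := zero_lt_one.trans ht
    have hpt : ∀ x, c x * g t x ^ p ≤ ENNReal.ofReal (t ^ (-m)) * G (P x + t • (x - P x)) := by
      intro x
      by_cases hx : x ∈ Kᶜ
      · have hdx := hd0 x hx
        have hdt := hP.infDist_homothety ht0.le x
        have hxt : P x + t • (x - P x) ∈ Kᶜ := by
          rw [Set.mem_compl_iff, hKcl.notMem_iff_infDist_pos hne, hdt]
          positivity
        simp only [c, G, g]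
        rw [Set.indicator_of_mem hx, Set.indicator_of_mem hxt, hdt, ← ofReal_norm,
          ENNReal.ofReal_rpow_of_nonneg (norm_nonneg _) hp0.le,
          ← ENNReal.ofReal_mul (weight_nonneg δ δ' hdx.le), ← ENNReal.ofReal_mul (by positivity)]
        refine ENNReal.ofReal_le_ofReal ?_
        rw [← mul_assoc]
        gcongr
        rw [Real.rpow_neg ht0.le, ← div_eq_inv_mul, le_div_iff₀ (by positivity), mul_comm]
        exact rpow_min_mul_weight_le δ δ' hdx ht.le
      · simp only [c]
        rw [Set.indicator_of_notMem hx, zero_mul]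
        exact zero_le
    calc ∫⁻ x, c x * g t x ^ p
        ≤ ∫⁻ x, ENNReal.ofReal (t ^ (-m)) * G (P x + t • (x - P x)) := lintegral_mono hpt
      _ = ENNReal.ofReal (t ^ (-m)) * ∫⁻ x, G (P x + t • (x - P x)) :=
          lintegral_const_mul' _ _ ENNReal.ofReal_ne_top
      _ ≤ ENNReal.ofReal (t ^ (-m)) * (ENNReal.ofReal (t ^ (-n)) * ∫⁻ x, G x) := by
          gcongr
          exact lintegral_comp_homothety_le hAB hdim' b hK hQ hP ht.le hG
      _ = _ := by
          rw [hGE, ← mul_assoc, ← ENNReal.ofReal_mul (by positivity), ← Real.rpow_add ht0]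
          congr 3
          rw [ha]
          field_simp
          ring
  have hmink := lintegral_rpow_lintegral_Ioi_le hp (by linarith) hc hg hM
  -- The ray from `P x` passes through `x` at t = 1 with speed equal to the distance, which cancels
  -- the factor d_Γ^(-p).
  have hmass : hardyMass p δ δ' Kᶜ φ ≤ ∫⁻ x, c x * (∫⁻ t in Set.Ioi 1, g t x) ^ p := by
    unfold hardyMass
    rw [← lintegral_indicator hKm]
    refine lintegral_mono fun x => ?_
    by_cases hx : x ∈ Kᶜ
    · have hdx := hd0 x hx
      have hN : x - P x ≠ 0 := by
        rw [hP.infDist_eq] at hdx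
        exact norm_pos_iff.1 hdx
      have hray := enorm_le_lintegral_fderiv_ray hφ1 hφc (P x) hN
      rw [add_sub_cancel, ← ofReal_norm (x - P x), ← hP.infDist_eq] at hray
      simp only [c]
      rw [Set.indicator_of_mem hx, Set.indicator_of_mem hx, bdryDist_compl, mul_assoc,
        ENNReal.ofReal_mul (weight_nonneg δ δ' hdx.le), Real.rpow_neg hdx.le,
        ← Real.inv_rpow hdx.le, ← Real.mul_rpow (by positivity) (abs_nonneg _),
        ← ENNReal.ofReal_rpow_of_nonneg (by positivity) hp0.le]
      gcongr
      rw [← div_eq_inv_mul, ENNReal.ofReal_div_of_pos hdx]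
      refine ENNReal.div_le_of_le_mul' ?_
      rwa [← Real.norm_eq_abs, ofReal_norm]
    · rw [Set.indicator_of_notMem hx]
      exact zero_le
  rw [add_sub_cancel_right] at hmink
  calc ENNReal.ofReal (a ^ p) * hardyMass p δ δ' Kᶜ φ
      ≤ ENNReal.ofReal (a ^ p) * (ENNReal.ofReal (a⁻¹ ^ p) * hardyEnergy p δ δ' Kᶜ φ) := by
        gcongr
        exact hmass.trans hmink
    _ = hardyEnergy p δ δ' Kᶜ φ := by
        rw [← mul_assoc, ← ENNReal.ofReal_mul (by positivity), ← Real.mul_rpow ha0.le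
          (by positivity), mul_inv_cancel₀ ha0.ne', Real.one_rpow, ENNReal.ofReal_one, one_mul]

end HardyInequality

/-! ### Full dimension at infinity yields large balls. -/

section LargeBalls

section Translates

variable {F : Type*} [NormedAddCommGroup F] [InnerProductSpace ℝ F] [FiniteDimensional ℝ F]
  [MeasurableSpace F] [BorelSpace F]

/-- The part of a convex set which a translation by `w` moves out of the set has pairwise disjoint
translates by the multiples of `w`. -/
theorem nsmul_volume_exit_le {K : Set F} (hcl : IsClosed K) (hcv : Convex ℝ K) (w : F) (R : ℝ)
    (N : ℕ) : N * volume {x | x ∈ K ∩ Metric.ball 0 R ∧ x + w ∉ K} ≤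
      volume (Metric.ball (0 : F) (R + N * ‖w‖)) := by
  set S : Set F := {x | x ∈ K ∩ Metric.ball 0 R ∧ x + w ∉ K} with hS
  have hSm : MeasurableSet S := by
    refine (hcl.measurableSet.inter measurableSet_ball).inter ?_
    exact (hcl.isOpen_compl.preimage (continuous_id.add continuous_const)).measurableSet
  let T : ℕ → Set F := fun j => (fun x => x + -((j : ℝ) • w)) ⁻¹' S
  have hT : ∀ j, volume (T j) = volume S := fun j => measure_preimage_add_right _ _ _
  have hTm : ∀ j, MeasurableSet (T j) := fun j => (measurable_add_const _) hSm
  have hlt : ∀ i j : ℕ, i < j → Disjoint (T i) (T j) := by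
    intro i j hij
    refine Set.disjoint_left.2 fun x hxi hxj => ?_
    obtain ⟨⟨hi, -⟩, -⟩ := hxi
    obtain ⟨⟨hj, -⟩, hj'⟩ := hxj
    -- If i < j and both x - jw and x - iw lie in `K`, then so does x - jw + w, being on the segment
    -- between them; this contradicts the exit condition.
    refine hj' ?_
    have hji : (1 : ℝ) ≤ (j : ℝ) - i := by
      have : (i : ℝ) + 1 ≤ j := by exact_mod_cast hij
      linarith
    have h0 : (0 : ℝ) < (j : ℝ) - i := by linarith
    have hconv := hcv hj hi (a := 1 - ((j : ℝ) - i)⁻¹) (b := ((j : ℝ) - i)⁻¹)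
      (sub_nonneg.2 (inv_le_one_of_one_le₀ hji)) (by positivity) (by ring)
    convert hconv using 1
    have h1 : ((j : ℝ) - i)⁻¹ * ((j : ℝ) - i) = 1 := inv_mul_cancel₀ h0.ne'
    generalize ((j : ℝ) - i)⁻¹ = c at h1 ⊢
    calc x + -((j : ℝ) • w) + w = x + -((j : ℝ) • w) + (c * ((j : ℝ) - i)) • w := by
          rw [h1, one_smul]
      _ = _ := by module
  have hdisj : (↑(Finset.range N) : Set ℕ).PairwiseDisjoint T := by
    intro i _ j _ hij
    rcases lt_or_gt_of_ne hij with h | h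
    · exact hlt i j h
    · exact (hlt j i h).symm
  calc N * volume S = ∑ j ∈ Finset.range N, volume (T j) := by simp [hT]
    _ = volume (⋃ j ∈ Finset.range N, T j) :=
        (measure_biUnion_finset hdisj fun j _ => hTm j).symm
    _ ≤ _ := by
        refine measure_mono (Set.iUnion₂_subset fun j hj x hx => ?_)
        have h1 : ‖x + -((j : ℝ) • w)‖ < R := mem_ball_zero_iff.1 hx.1.2
        have h2 : (j : ℝ) ≤ N := by exact_mod_cast (Finset.mem_range.1 hj).le
        rw [mem_ball_zero_iff]
        calc ‖x‖ = ‖(x + -((j : ℝ) • w)) + (j : ℝ) • w‖ := by congr 1; abel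
          _ ≤ ‖x + -((j : ℝ) • w)‖ + ‖(j : ℝ) • w‖ := norm_add_le _ _
          _ < R + N * ‖w‖ := by
            rw [norm_smul, Real.norm_natCast]
            exact add_lt_add_of_lt_of_le h1 (mul_le_mul_of_nonneg_right h2 (norm_nonneg _))

/-- About R/ρ disjoint copies of the exit set fit into a ball of radius 3R, so each has volume
O(R^(dim - 1)). -/
theorem volume_exit_le {K : Set F} (hcl : IsClosed K) (hcv : Convex ℝ K) {w : F} {ρ R : ℝ}
    (hρ : 0 < ρ) (hw : ‖w‖ = ρ) (hR : ρ ≤ R) :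
    volume {x | x ∈ K ∩ Metric.ball 0 R ∧ x + w ∉ K} ≤
      ENNReal.ofReal (ρ * 3 ^ Module.finrank ℝ F * R ^ ((Module.finrank ℝ F : ℝ) - 1)) *
        volume (Metric.ball (0 : F) 1) := by
  have hR0 : 0 < R := hρ.trans_le hR
  set V := volume {x | x ∈ K ∩ Metric.ball 0 R ∧ x + w ∉ K}
  set n := Module.finrank ℝ F
  have h1 := nsmul_volume_exit_le hcl hcv w R ⌈R / ρ⌉₊
  have h2 : ENNReal.ofReal (R / ρ) ≤ (⌈R / ρ⌉₊ : ℝ≥0∞) := by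
    rw [← ENNReal.ofReal_natCast]
    exact ENNReal.ofReal_le_ofReal (Nat.le_ceil _)
  have h3 : R + ⌈R / ρ⌉₊ * ‖w‖ ≤ 3 * R := by
    rw [hw]
    have := (Nat.ceil_lt_add_one (div_pos hR0 hρ).le).le
    have h4 : (⌈R / ρ⌉₊ : ℝ) * ρ ≤ (R / ρ + 1) * ρ := by gcongr
    rw [add_mul, div_mul_cancel₀ _ hρ.ne'] at h4
    linarith
  have h5 : ENNReal.ofReal (R / ρ) * V ≤
      ENNReal.ofReal ((3 * R) ^ n) * volume (Metric.ball (0 : F) 1) := by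
    rw [← Measure.addHaar_ball_of_pos volume (0 : F) (by positivity : 0 < 3 * R)]
    exact ((mul_le_mul_left h2 _).trans h1).trans (measure_mono (Metric.ball_subset_ball h3))
  calc V = ENNReal.ofReal (ρ / R) * (ENNReal.ofReal (R / ρ) * V) := by
        rw [← mul_assoc, ← ENNReal.ofReal_mul (by positivity)]
        rw [div_mul_div_cancel₀ hR0.ne', div_self hρ.ne', ENNReal.ofReal_one, one_mul]
    _ ≤ ENNReal.ofReal (ρ / R) *
          (ENNReal.ofReal ((3 * R) ^ n) * volume (Metric.ball (0 : F) 1)) := by gcongr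
    _ = _ := by
        rw [← mul_assoc, ← ENNReal.ofReal_mul (by positivity)]
        congr 2
        rw [Real.rpow_sub hR0, Real.rpow_natCast, Real.rpow_one, mul_pow]
        ring

end Translates

variable {k : ℕ}

/-- A convex set containing the vertices of a cross-polytope contains the inscribed ball. -/
theorem closedBall_subset_of_vertices {K : Set (EuclideanSpace ℝ (Fin k))} (hcv : Convex ℝ K)
    (hk : 1 ≤ k) {x : EuclideanSpace ℝ (Fin k)} {r : ℝ} (hr : 0 < r)
    (h : ∀ i : Fin k, x + EuclideanSpace.single i (k * r) ∈ K ∧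
      x + EuclideanSpace.single i (-(k * r)) ∈ K) : Metric.closedBall x r ⊆ K := by
  intro y hy
  have hk0 : (0 : ℝ) < k := by exact_mod_cast hk
  rw [Metric.mem_closedBall, dist_eq_norm] at hy
  set u := y - x with hu
  -- The point `y` is the average of the `k` points x + k u_i e_i, each on a diagonal of the
  -- cross-polytope because |u_i| ≤ r. This explains the factor `k` in the vertices.
  have hmem : ∀ i : Fin k, x + EuclideanSpace.single i (k * u i) ∈ K := by
    intro i
    have hui : |u i| ≤ r := by
      rw [← Real.norm_eq_abs]
      exact (PiLp.norm_apply_le u i).trans hy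
    obtain ⟨h1, h2⟩ := abs_le.1 hui
    have h3 := hcv (h i).1 (h i).2 (a := (r + u i) / (2 * r)) (b := (r - u i) / (2 * r))
      (div_nonneg (by linarith) (by linarith)) (div_nonneg (by linarith) (by linarith))
      (by field_simp; ring)
    convert h3 using 1
    ext j
    by_cases hj : j = i
    · subst hj
      simp
      field_simp
      ring
    · simp [hj]
      field_simp
      ring
  have hsum := hcv.sum_mem (t := Finset.univ) (w := fun _ : Fin k => (k : ℝ)⁻¹)
    (z := fun i => x + EuclideanSpace.single i (k * u i)) (fun _ _ => by positivity)
    (by simp [hk0.ne']) (fun i _ => hmem i)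
  convert hsum using 1
  ext j
  simp [Finset.sum_add_distrib, Pi.single_apply, hk0.ne', hu]

/-- If all 2k translates of a point by ± k r e_i stayed in `K`, the cross-polytope would put a ball
of radius `r` in `K`. So every point of `K` exits in one of these directions, and the exit sets have
volume of order R^(k-1). -/
theorem volume_inter_ball_le_of_no_ball {K : Set (EuclideanSpace ℝ (Fin k))} (hcl : IsClosed K)
    (hcv : Convex ℝ K) (hk : 1 ≤ k) {r : ℝ} (hr : 0 < r)
    (hK : ∀ x, ¬ Metric.closedBall x r ⊆ K) :
    ∃ C : ℝ, 0 ≤ C ∧ ∀ R, k * r ≤ R →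
      volume (K ∩ Metric.ball 0 R) ≤ ENNReal.ofReal (C * R ^ ((k : ℝ) - 1)) := by
  have hk0 : (0 : ℝ) < k := by exact_mod_cast hk
  set ρ := k * r with hρ
  have hρ0 : 0 < ρ := by positivity
  set ω := (volume (Metric.ball (0 : EuclideanSpace ℝ (Fin k)) 1)).toReal with hω
  have hω' : volume (Metric.ball (0 : EuclideanSpace ℝ (Fin k)) 1) = ENNReal.ofReal ω :=
    (ENNReal.ofReal_toReal measure_ball_lt_top.ne).symm
  have hω0 : 0 ≤ ω := ENNReal.toReal_nonneg
  refine ⟨k * (2 * (ρ * 3 ^ k * ω)), by positivity, fun R hR => ?_⟩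
  have hR0 : 0 < R := hρ0.trans_le hR
  let S : EuclideanSpace ℝ (Fin k) → Set (EuclideanSpace ℝ (Fin k)) := fun w =>
    {x | x ∈ K ∩ Metric.ball 0 R ∧ x + w ∉ K}
  have hS : ∀ w, ‖w‖ = ρ → volume (S w) ≤ ENNReal.ofReal (ρ * 3 ^ k * ω * R ^ ((k : ℝ) - 1)) := by
    intro w hw
    have := volume_exit_le hcl hcv hρ0 hw hR
    rw [finrank_euclideanSpace_fin, hω', ← ENNReal.ofReal_mul (by positivity)] at this
    refine this.trans_eq ?_
    congr 1
    ring
  have hcov : K ∩ Metric.ball 0 R ⊆ ⋃ i : Fin k,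
      (S (EuclideanSpace.single i ρ) ∪ S (EuclideanSpace.single i (-ρ))) := by
    intro x hx
    by_contra hnot
    simp only [Set.mem_iUnion, Set.mem_union, not_exists, not_or] at hnot
    refine hK x (closedBall_subset_of_vertices hcv hk hr fun i => ?_)
    obtain ⟨h1, h2⟩ := hnot i
    exact ⟨by_contra fun h => h1 ⟨hx, h⟩, by_contra fun h => h2 ⟨hx, h⟩⟩
  calc volume (K ∩ Metric.ball 0 R)
      ≤ ∑ i : Fin k, volume (S (EuclideanSpace.single i ρ) ∪ S (EuclideanSpace.single i (-ρ))) :=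
        (measure_mono hcov).trans (measure_iUnion_fintype_le _ _)
    _ ≤ ∑ i : Fin k, ENNReal.ofReal (2 * (ρ * 3 ^ k * ω * R ^ ((k : ℝ) - 1))) := by
        refine Finset.sum_le_sum fun i _ => (measure_union_le _ _).trans ?_
        rw [two_mul, ENNReal.ofReal_add (by positivity) (by positivity)]
        refine add_le_add (hS _ ?_) (hS _ ?_) <;> simp [abs_of_pos hρ0]
    _ = _ := by
        rw [Finset.sum_const, Finset.card_univ, Fintype.card_fin, nsmul_eq_mul,
          ← ENNReal.ofReal_natCast, ← ENNReal.ofReal_mul (by positivity)]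
        congr 1
        ring

/-- A closed convex set of full dimension at infinity contains arbitrarily large balls. -/
theorem exists_closedBall_subset_of_dimAtInfinity {K : Set (EuclideanSpace ℝ (Fin k))}
    (hcl : IsClosed K) (hcv : Convex ℝ K) (hk : 1 ≤ k) (hdim : dimAtInfinity K = (k : EReal))
    (r : ℝ) (hr : 0 < r) : ∃ x, Metric.closedBall x r ⊆ K := by
  by_contra! hK
  obtain ⟨C, hC0, hC⟩ := volume_inter_ball_le_of_no_ball hcl hcv hk hr hK
  -- Half a power of R absorbs the constant `C` and still leaves an exponent below k.
  have hlarge : ∀ᶠ R : ℝ in atTop, ENNReal.log (volume (K ∩ Metric.ball 0 R)) /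
      (Real.log R : EReal) ≤ (((k : ℝ) - 1 / 2 : ℝ) : EReal) := by
    have hpow : ∀ᶠ R : ℝ in atTop, C ≤ R ^ (1 / 2 : ℝ) :=
      (tendsto_rpow_atTop (by norm_num)).eventually_ge_atTop C
    filter_upwards [hpow, eventually_ge_atTop (k * r), eventually_gt_atTop 1] with R h1 h2 h3
    have hR0 : 0 < R := zero_lt_one.trans h3
    have hlog : 0 < Real.log R := Real.log_pos h3
    have h4 : volume (K ∩ Metric.ball 0 R) ≤ ENNReal.ofReal (R ^ ((k : ℝ) - 1 / 2)) := by
      refine (hC R h2).trans (ENNReal.ofReal_le_ofReal ?_)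
      calc C * R ^ ((k : ℝ) - 1) ≤ R ^ (1 / 2 : ℝ) * R ^ ((k : ℝ) - 1) := by gcongr
        _ = R ^ ((k : ℝ) - 1 / 2) := by rw [← Real.rpow_add hR0]; congr 1; ring
    have h5 : ENNReal.log (ENNReal.ofReal (R ^ ((k : ℝ) - 1 / 2))) =
        ((((k : ℝ) - 1 / 2) * Real.log R : ℝ) : EReal) := by
      rw [ENNReal.log_ofReal_of_pos (by positivity), Real.log_rpow hR0]
    rw [EReal.div_le_iff_le_mul (by exact_mod_cast hlog) (EReal.coe_ne_top _)]
    refine (ENNReal.log_le_log_iff.2 h4).trans_eq ?_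
    rw [h5, mul_comm]
    norm_cast
  have hle : dimAtInfinity K ≤ (((k : ℝ) - 1 / 2 : ℝ) : EReal) := by
    unfold dimAtInfinity
    exact liminf_le_of_frequently_le' hlarge.frequently
  rw [hdim] at hle
  have : (k : ℝ) ≤ (k : ℝ) - 1 / 2 := by
    rw [← EReal.coe_le_coe_iff]
    exact_mod_cast hle
  linarith

end LargeBalls

/-! ### Cutoffs in balls and on a logarithmic scale. -/

section Cutoffs

/-- Cutoff functions of balls of all radii whose derivatives scale with the radius. -/
theorem exists_cutoff (Y : Type*) [NormedAddCommGroup Y] [InnerProductSpace ℝ Y]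
    [FiniteDimensional ℝ Y] : ∃ C : ℝ, 0 ≤ C ∧ ∀ (y₀ : Y) (ρ : ℝ), 0 < ρ → ∃ u : Y → ℝ,
      ContDiff ℝ 1 u ∧ (∀ y, 0 ≤ u y) ∧ (∀ y, u y ≤ 1) ∧
      (∀ y ∈ Metric.closedBall y₀ ρ, u y = 1) ∧
      (∀ y ∉ Metric.closedBall y₀ (2 * ρ), u y = 0) ∧
      (∀ y ∉ Metric.closedBall y₀ (2 * ρ), fderiv ℝ u y = 0) ∧
      ∀ y, ‖fderiv ℝ u y‖ ≤ C / ρ := by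
  let f : ContDiffBump (0 : Y) := ⟨1, 2, one_pos, one_lt_two⟩
  have hf : ContDiff ℝ 1 f := f.contDiff
  obtain ⟨C, hC⟩ := f.hasCompactSupport.fderiv (𝕜 := ℝ) |>.exists_bound_of_continuous
    (hf.continuous_fderiv one_ne_zero)
  refine ⟨C, (norm_nonneg _).trans (hC 0), fun y₀ ρ hρ => ?_⟩
  have hout : ∀ y ∉ Metric.closedBall y₀ (2 * ρ), f (ρ⁻¹ • (y - y₀)) = 0 := by
    intro y hy
    refine f.zero_of_le_dist ?_
    rw [Metric.mem_closedBall, not_le, dist_eq_norm] at hy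
    rw [dist_zero_right, norm_smul, Real.norm_of_nonneg (by positivity), ← div_eq_inv_mul,
      le_div_iff₀ hρ]
    exact hy.le
  refine ⟨fun y => f (ρ⁻¹ • (y - y₀)), by fun_prop, fun y => f.nonneg, fun y => f.le_one,
    fun y hy => ?_, hout, fun y hy => ?_, fun y => ?_⟩
  · refine f.one_of_mem_closedBall ?_
    rw [Metric.mem_closedBall, dist_eq_norm] at hy
    rw [mem_closedBall_zero_iff, norm_smul, Real.norm_of_nonneg (by positivity), ← div_eq_inv_mul]
    exact (div_le_one hρ).2 hy
  · have : (fun y => f (ρ⁻¹ • (y - y₀))) =ᶠ[nhds y] fun _ => 0 := by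
      filter_upwards [Metric.isClosed_closedBall.isOpen_compl.mem_nhds hy] with x hx
      exact hout x hx
    rw [this.fderiv_eq]
    simp
  · have h1 : HasFDerivAt (fun y : Y => ρ⁻¹ • (y - y₀)) (ρ⁻¹ • ContinuousLinearMap.id ℝ Y) y :=
      ((hasFDerivAt_id y).sub_const y₀).const_smul ρ⁻¹
    have h2 := ((hf.differentiable one_ne_zero _).hasFDerivAt.comp y h1).fderiv
    rw [Function.comp_def] at h2
    rw [h2, ContinuousLinearMap.comp_smul, ContinuousLinearMap.comp_id, norm_smul,
      Real.norm_of_nonneg (by positivity), ← div_eq_inv_mul]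
    gcongr
    exact hC _

/-- The radial function `‖z‖ ^ (-a) H(log ‖z‖ / N)`, a power cut off on a logarithmic scale. -/
noncomputable def radialPower {Z : Type*} [Norm Z] (a N : ℝ) (H : ℝ → ℝ) (z : Z) : ℝ :=
  ‖z‖ ^ (-a) * H (Real.log ‖z‖ / N)

theorem radialPower_eq_zero {Z : Type*} [NormedAddCommGroup Z] {a N β : ℝ} {H : ℝ → ℝ} (ha : 0 < a) (hN : 0 < N)
    (hH : ∀ τ < β, H τ = 0) {z : Z} (hz : ‖z‖ < Real.exp (β * N)) : radialPower a N H z = 0 := by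
  unfold radialPower
  rcases eq_or_ne z 0 with rfl | h0
  -- At the origin `0 ^ (-a)` takes the value 0, since a ≠ 0.
  · rw [norm_zero, Real.zero_rpow (neg_ne_zero.2 ha.ne'), zero_mul]
  · rw [hH, mul_zero]
    rw [div_lt_iff₀ hN]
    exact (Real.log_lt_iff_lt_exp (norm_pos_iff.2 h0)).2 hz

variable {Z : Type*} [NormedAddCommGroup Z] [InnerProductSpace ℝ Z]

theorem contDiff_radialPower {a N β : ℝ} {H : ℝ → ℝ} (ha : 0 < a) (hN : 0 < N)
    (hHd : ContDiff ℝ 1 H) (hH : ∀ τ < β, H τ = 0) :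
    ContDiff ℝ 1 (radialPower (Z := Z) a N H) := by
  rw [contDiff_iff_contDiffAt]
  intro z
  rcases eq_or_ne z 0 with rfl | h0
  · have : radialPower (Z := Z) a N H =ᶠ[nhds 0] fun _ => 0 := by
      filter_upwards [Metric.ball_mem_nhds (0 : Z) (Real.exp_pos (β * N))] with z hz
      exact radialPower_eq_zero ha hN hH (mem_ball_zero_iff.1 hz)
    exact contDiffAt_const.congr_of_eventuallyEq this
  · have h1 : ContDiffAt ℝ 1 (fun z : Z => ‖z‖) z := contDiffAt_norm ℝ h0
    have h2 : ‖z‖ ≠ 0 := norm_ne_zero_iff.2 h0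
    refine (h1.rpow_const_of_ne h2).mul ?_
    exact hHd.contDiffAt.comp z ((h1.log h2).div_const N)

/-- Differentiating H(log s / N) produces 1/(N s): at every scale the cutoff costs only 1/N relative
to the derivative of the power. -/
theorem norm_fderiv_radialPower_le {a N : ℝ} {H : ℝ → ℝ} (ha : 0 < a) (hN : 0 < N)
    (hHd : ContDiff ℝ 1 H) (hH0 : ∀ τ, 0 ≤ H τ) {z : Z} (hz : z ≠ 0) :
    ‖fderiv ℝ (radialPower a N H) z‖ ≤ ‖z‖ ^ (-a - 1) *
      (a * H (Real.log ‖z‖ / N) + |deriv H (Real.log ‖z‖ / N)| / N) := by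
  have hs : 0 < ‖z‖ := norm_pos_iff.2 hz
  set s := ‖z‖ with hsdef
  have h1 : HasDerivAt (fun s : ℝ => s ^ (-a) * H (Real.log s / N))
      (-a * s ^ (-a - 1) * H (Real.log s / N) +
        s ^ (-a) * (deriv H (Real.log s / N) * (s⁻¹ / N))) s := by
    refine (Real.hasDerivAt_rpow_const (Or.inl hs.ne')).mul ?_
    exact (hHd.differentiable one_ne_zero _).hasDerivAt.comp s
      ((Real.hasDerivAt_log hs.ne').div_const N)
  have h2 : DifferentiableAt ℝ (fun z : Z => ‖z‖) z :=
    (contDiffAt_norm ℝ hz (n := 1)).differentiableAt one_ne_zero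
  have h3 := (h1.comp_hasFDerivAt z h2.hasFDerivAt).fderiv
  have h4 : ‖fderiv ℝ (fun z : Z => ‖z‖) z‖ ≤ 1 := by
    simpa using norm_fderiv_le_of_lipschitz ℝ (x₀ := z) lipschitzWith_one_norm
  change fderiv ℝ (radialPower a N H) z = _ at h3
  rw [h3, norm_smul]
  refine (mul_le_of_le_one_right (norm_nonneg _) h4).trans ?_
  have h5 : s ^ (-a) * s⁻¹ = s ^ (-a - 1) := by
    rw [Real.rpow_sub_one hs.ne', div_eq_mul_inv]
  have h6 : 0 < s ^ (-a - 1) := Real.rpow_pos_of_pos hs _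
  have h7 : -a * s ^ (-a - 1) * H (Real.log s / N) +
        s ^ (-a) * (deriv H (Real.log s / N) * (s⁻¹ / N)) =
      s ^ (-a - 1) * (-(a * H (Real.log s / N)) + deriv H (Real.log s / N) / N) := by
    rw [← h5]
    ring
  rw [h7, norm_mul, Real.norm_of_nonneg h6.le]
  gcongr
  refine (norm_add_le _ _).trans_eq ?_
  rw [norm_neg, norm_div, Real.norm_of_nonneg (mul_nonneg ha.le (hH0 _)), Real.norm_eq_abs,
    Real.norm_of_nonneg hN.le]

end Cutoffs

/-! ### Comparison of the weight with pure powers on (0,1] and on [1,∞). -/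

section WeightAsymptotics

theorem rpow_mem_Icc_of_mem_Icc_one_two {x : ℝ} (h1 : 1 ≤ x) (h2 : x ≤ 2) (η : ℝ) :
    x ^ η ∈ Set.Icc ((2 : ℝ) ^ (-|η|)) (2 ^ |η|) := by
  have hx : 0 < x := zero_lt_one.trans_le h1
  constructor
  · calc (2 : ℝ) ^ (-|η|) ≤ x ^ (-|η|) :=
        Real.rpow_le_rpow_of_nonpos hx h2 (neg_nonpos.2 (abs_nonneg _))
      _ ≤ x ^ η := Real.rpow_le_rpow_of_exponent_le h1 (neg_abs_le η)
  · calc x ^ η ≤ x ^ |η| := Real.rpow_le_rpow_of_exponent_le h1 (le_abs_self η)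
      _ ≤ 2 ^ |η| := by gcongr

theorem weight_mem_Icc_of_le_one (δ δ' : ℝ) {s : ℝ} (hs : 0 < s) (h1 : s ≤ 1) :
    weight δ δ' s ∈ Set.Icc ((2 : ℝ) ^ (-|δ' - δ|) * s ^ δ) (2 ^ |δ' - δ| * s ^ δ) := by
  obtain ⟨h2, h3⟩ := rpow_mem_Icc_of_mem_Icc_one_two (x := 1 + s) (by linarith) (by linarith)
    (δ' - δ)
  unfold weight
  rw [mul_comm (s ^ δ)]
  exact ⟨by gcongr, by gcongr⟩

theorem weight_mem_Icc_of_one_le (δ δ' : ℝ) {s : ℝ} (h1 : 1 ≤ s) :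
    weight δ δ' s ∈ Set.Icc ((2 : ℝ) ^ (-|δ' - δ|) * s ^ δ') (2 ^ |δ' - δ| * s ^ δ') := by
  have hs : 0 < s := zero_lt_one.trans_le h1
  obtain ⟨h2, h3⟩ := rpow_mem_Icc_of_mem_Icc_one_two (x := (1 + s) / s)
    ((one_le_div hs).2 (by linarith)) ((div_le_iff₀ hs).2 (by linarith)) (δ' - δ)
  have h4 : weight δ δ' s = ((1 + s) / s) ^ (δ' - δ) * s ^ δ' := by
    unfold weight
    rw [Real.div_rpow (by positivity) hs.le]
    nth_rw 4 [show δ' = (δ' - δ) + δ by ring]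
    rw [Real.rpow_add hs]
    field_simp
  rw [h4]
  exact ⟨by gcongr, by gcongr⟩

end WeightAsymptotics

/-! ### Dilation-invariant measure of logarithmic shells. -/

section LogShells

variable {Z : Type*} [NormedAddCommGroup Z] [InnerProductSpace ℝ Z] [FiniteDimensional ℝ Z]

/-- The spherical shell `α ≤ log ‖z‖ ≤ β`. -/
def logShell (Z : Type*) [Norm Z] (α β : ℝ) : Set Z :=
  {z | Real.exp α ≤ ‖z‖ ∧ ‖z‖ ≤ Real.exp β}

theorem isCompact_logShell (α β : ℝ) : IsCompact (logShell Z α β) := by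
  refine (isCompact_closedBall (0 : Z) (Real.exp β)).of_isClosed_subset ?_ fun z hz =>
    mem_closedBall_zero_iff.2 hz.2
  exact (isClosed_le continuous_const continuous_norm).inter
    (isClosed_le continuous_norm continuous_const)

variable [MeasurableSpace Z] [BorelSpace Z]

/-- The measure `‖z‖ ^ (-dim Z) dz` of logarithmic shells is invariant under dilations. -/
theorem lintegral_logShell_add (α β γ : ℝ) :
    ∫⁻ z in logShell Z (α + γ) (β + γ), ENNReal.ofReal (‖z‖ ^ (-(Module.finrank ℝ Z : ℝ))) =
      ∫⁻ z in logShell Z α β, ENNReal.ofReal (‖z‖ ^ (-(Module.finrank ℝ Z : ℝ))) := by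
  set n : ℝ := (Module.finrank ℝ Z : ℝ)
  set t := Real.exp γ with ht
  have ht0 : 0 < t := Real.exp_pos γ
  have hm : ∀ α β, MeasurableSet (logShell Z α β) := fun α β =>
    (isCompact_logShell α β).isClosed.measurableSet
  rw [← lintegral_indicator (hm _ _), ← lintegral_indicator (hm _ _)]
  have hG : Measurable ((logShell Z (α + γ) (β + γ)).indicator fun z =>
      ENNReal.ofReal (‖z‖ ^ (-n))) := by
    refine Measurable.indicator ?_ (hm _ _)
    exact (measurable_norm.pow_const _).ennreal_ofReal
  have h1 := lintegral_comp_smul_eq ht0 hG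
  have h2 : ∀ z : Z, (logShell Z (α + γ) (β + γ)).indicator
      (fun z => ENNReal.ofReal (‖z‖ ^ (-n))) (t • z) = ENNReal.ofReal (t ^ (-n)) *
        (logShell Z α β).indicator (fun z => ENNReal.ofReal (‖z‖ ^ (-n))) z := by
    intro z
    have hiff : t • z ∈ logShell Z (α + γ) (β + γ) ↔ z ∈ logShell Z α β := by
      simp only [logShell, Set.mem_ofPred_eq, norm_smul, Real.norm_of_nonneg ht0.le, Real.exp_add,
        ← ht]
      rw [mul_comm t, mul_le_mul_iff_left₀ ht0, mul_le_mul_iff_left₀ ht0]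
    by_cases hz : z ∈ logShell Z α β
    · rw [Set.indicator_of_mem (hiff.2 hz), Set.indicator_of_mem hz, norm_smul,
        Real.norm_of_nonneg ht0.le, Real.mul_rpow ht0.le (norm_nonneg _),
        ENNReal.ofReal_mul (by positivity)]
    · rw [Set.indicator_of_notMem (hiff.not.2 hz), Set.indicator_of_notMem hz, mul_zero]
  simp_rw [h2] at h1
  rw [lintegral_const_mul' _ _ ENNReal.ofReal_ne_top] at h1
  refine ((ENNReal.mul_right_inj ?_ ENNReal.ofReal_ne_top).1 h1).symm
  have : 0 < t ^ (-n) := Real.rpow_pos_of_pos ht0 _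
  simpa using this

/-- The large shell splits into three dilates of its middle third. This compares the whole support
of the cutoff with the part where it equals 1. -/
theorem lintegral_logShell_three_mul_le (β : ℝ) (N : ℝ) :
    ∫⁻ z in logShell Z (β * N) ((β + 3) * N),
        ENNReal.ofReal (‖z‖ ^ (-(Module.finrank ℝ Z : ℝ))) ≤
      3 * ∫⁻ z in logShell Z ((β + 1) * N) ((β + 2) * N),
        ENNReal.ofReal (‖z‖ ^ (-(Module.finrank ℝ Z : ℝ))) := by
  set I := ∫⁻ z in logShell Z ((β + 1) * N) ((β + 2) * N),
    ENNReal.ofReal (‖z‖ ^ (-(Module.finrank ℝ Z : ℝ)))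
  have h1 : ∫⁻ z in logShell Z (β * N) ((β + 1) * N),
      ENNReal.ofReal (‖z‖ ^ (-(Module.finrank ℝ Z : ℝ))) = I := by
    have h := lintegral_logShell_add (Z := Z) (β * N) ((β + 1) * N) N
    rw [show β * N + N = (β + 1) * N by ring, show (β + 1) * N + N = (β + 2) * N by ring] at h
    exact h.symm
  have h2 : ∫⁻ z in logShell Z ((β + 2) * N) ((β + 3) * N),
      ENNReal.ofReal (‖z‖ ^ (-(Module.finrank ℝ Z : ℝ))) = I := by
    have h := lintegral_logShell_add (Z := Z) ((β + 1) * N) ((β + 2) * N) N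
    rw [show (β + 1) * N + N = (β + 2) * N by ring,
      show (β + 2) * N + N = (β + 3) * N by ring] at h
    exact h
  have hsub : logShell Z (β * N) ((β + 3) * N) ⊆
      (logShell Z (β * N) ((β + 1) * N) ∪ logShell Z ((β + 1) * N) ((β + 2) * N)) ∪
        logShell Z ((β + 2) * N) ((β + 3) * N) := by
    rintro z ⟨hz1, hz2⟩
    rcases le_total ‖z‖ (Real.exp ((β + 1) * N)) with h | h
    · exact Or.inl (Or.inl ⟨hz1, h⟩)
    · rcases le_total ‖z‖ (Real.exp ((β + 2) * N)) with h' | h'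
      · exact Or.inl (Or.inr ⟨h, h'⟩)
      · exact Or.inr ⟨h', hz2⟩
  refine (lintegral_mono_set hsub).trans ?_
  refine (lintegral_union_le _ _ _).trans ?_
  refine (add_le_add (lintegral_union_le _ _ _) le_rfl).trans ?_
  rw [h1, h2]
  exact le_of_eq (by ring)

end LogShells

/-! ### Coordinate maps as adjoints of the isometric embeddings. -/

section AdjointCoordinates

variable {Y Z E : Type*} [NormedAddCommGroup Y] [InnerProductSpace ℝ Y]
  [NormedAddCommGroup Z] [InnerProductSpace ℝ Z]
  [NormedAddCommGroup E] [InnerProductSpace ℝ E] [CompleteSpace E]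

/-- The coordinate in `Y` of a point of `E` with respect to the isometric embedding
`y ↦ b + A y`. -/
noncomputable def adjointCoord [CompleteSpace Y] (A : Y →ₗᵢ[ℝ] E) (b x : E) : Y :=
  A.toContinuousLinearMap.adjoint (x - b)

theorem adjointCoord_add_left [CompleteSpace Y] {A : Y →ₗᵢ[ℝ] E} {B : Z →ₗᵢ[ℝ] E}
    (hAB : ∀ y z, inner ℝ (A y) (B z) = 0) (b : E) (y : Y) (z : Z) :
    adjointCoord A b (b + (A y + B z)) = y := by
  refine ext_inner_left ℝ fun v => ?_
  rw [adjointCoord, add_sub_cancel_left, ContinuousLinearMap.adjoint_inner_right]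
  change inner ℝ (A v) (A y + B z) = _
  rw [inner_add_right, A.inner_map_map, hAB, add_zero]

theorem adjointCoord_add_right [CompleteSpace Z] {A : Y →ₗᵢ[ℝ] E} {B : Z →ₗᵢ[ℝ] E}
    (hAB : ∀ y z, inner ℝ (A y) (B z) = 0) (b : E) (y : Y) (z : Z) :
    adjointCoord B b (b + (A y + B z)) = z := by
  rw [add_comm (A y)]
  refine adjointCoord_add_left (fun z y => ?_) b z y
  rw [real_inner_comm, hAB]

theorem contDiff_adjointCoord [CompleteSpace Y] (A : Y →ₗᵢ[ℝ] E) (b : E) : ContDiff ℝ 1 (adjointCoord A b) := by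
  unfold adjointCoord
  fun_prop

theorem norm_fderiv_comp_adjointCoord_le [CompleteSpace Y] (A : Y →ₗᵢ[ℝ] E) (b : E) {u : Y → ℝ}
    (hu : ContDiff ℝ 1 u) (x : E) :
    ‖fderiv ℝ (fun x => u (adjointCoord A b x)) x‖ ≤ ‖fderiv ℝ u (adjointCoord A b x)‖ := by
  have h1 : HasFDerivAt (adjointCoord A b) A.toContinuousLinearMap.adjoint x :=
    A.toContinuousLinearMap.adjoint.hasFDerivAt.comp x ((hasFDerivAt_id x).sub_const b)
  have h2 := ((hu.differentiable one_ne_zero _).hasFDerivAt.comp x h1).fderiv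
  change fderiv ℝ (fun x => u (adjointCoord A b x)) x = _ at h2
  rw [h2]
  refine (ContinuousLinearMap.opNorm_comp_le _ _).trans (mul_le_of_le_one_right (norm_nonneg _) ?_)
  rw [LinearIsometryEquiv.norm_map]
  exact A.norm_toContinuousLinearMap_le

end AdjointCoordinates

/-! ### Distance and integration over cylinders above the set. -/

section Cylinders

variable {Y Z E : Type*} [NormedAddCommGroup Y] [InnerProductSpace ℝ Y]
  [NormedAddCommGroup Z] [InnerProductSpace ℝ Z] [NormedAddCommGroup E] [InnerProductSpace ℝ E]
  {A : Y →ₗᵢ[ℝ] E} {B : Z →ₗᵢ[ℝ] E} {b : E} {K : Set E}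

/-- The foot of the perpendicular to the hull already lies in `K`, so the distance to `K` is the
distance to the hull. -/
theorem infDist_orthogonal_add (hAB : ∀ y z, inner ℝ (A y) (B z) = 0)
    (hK : ∀ x ∈ K, ∃ y, x = b + A y) {y : Y} (hy : b + A y ∈ K) (z : Z) :
    Metric.infDist (b + (A y + B z)) K = ‖z‖ := by
  rw [infDist_eq_of_inner_le_zero hy, ← add_assoc, add_sub_cancel_left, B.norm_map]
  intro w hw
  obtain ⟨y', rfl⟩ := hK w hw
  rw [← add_assoc, add_sub_cancel_left, add_sub_add_left_eq_sub, ← map_sub, real_inner_comm, hAB]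

variable [FiniteDimensional ℝ Y] [FiniteDimensional ℝ Z] [FiniteDimensional ℝ E]

/-- The product `{b + A y + B z | y ∈ U, z ∈ T}`. -/
def orthogonalCylinder (A : Y →ₗᵢ[ℝ] E) (B : Z →ₗᵢ[ℝ] E) (b : E) (U : Set Y) (T : Set Z) : Set E :=
  {x | adjointCoord A b x ∈ U ∧ adjointCoord B b x ∈ T}

theorem isCompact_orthogonalCylinder (hAB : ∀ y z, inner ℝ (A y) (B z) = 0)
    (hdim : Module.finrank ℝ Y + Module.finrank ℝ Z = Module.finrank ℝ E)
    {U : Set Y} {T : Set Z} (hU : IsCompact U) (hT : IsCompact T) :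
    IsCompact (orthogonalCylinder A B b U T) := by
  have h : orthogonalCylinder A B b U T = (fun q : Y × Z => b + (A q.1 + B q.2)) '' (U ×ˢ T) := by
    ext x
    obtain ⟨y, z, rfl⟩ := exists_eq_orthogonal_add hAB hdim b x
    simp only [orthogonalCylinder, Set.mem_ofPred_eq, adjointCoord_add_left hAB,
      adjointCoord_add_right hAB]
    constructor
    · rintro ⟨hy, hz⟩
      exact ⟨(y, z), ⟨hy, hz⟩, rfl⟩
    · rintro ⟨⟨y', z'⟩, ⟨hy, hz⟩, heq⟩
      have h1 := congrArg (adjointCoord A b) heq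
      have h2 := congrArg (adjointCoord B b) heq
      simp only [adjointCoord_add_left hAB, adjointCoord_add_right hAB] at h1 h2
      subst h1 h2
      exact ⟨hy, hz⟩
  rw [h]
  refine (hU.prod hT).image ?_
  have := A.continuous
  have := B.continuous
  fun_prop

variable [MeasurableSpace Y] [BorelSpace Y] [MeasurableSpace Z] [BorelSpace Z]
  [MeasurableSpace E] [BorelSpace E]

theorem setLIntegral_orthogonalCylinder_infDist (hAB : ∀ y z, inner ℝ (A y) (B z) = 0)
    (hdim : Module.finrank ℝ Y + Module.finrank ℝ Z = Module.finrank ℝ E)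
    (hK : ∀ x ∈ K, ∃ y, x = b + A y) {U : Set Y} {T : Set Z} (hUm : MeasurableSet U)
    (hTm : MeasurableSet T) (hU : ∀ y ∈ U, b + A y ∈ K) {f : ℝ → ℝ≥0∞} (hf : Measurable f) :
    ∫⁻ x in orthogonalCylinder A B b U T, f (Metric.infDist x K) = volume U * ∫⁻ z in T, f ‖z‖ := by
  have hS : MeasurableSet (orthogonalCylinder A B b U T) :=
    ((contDiff_adjointCoord A b).continuous.measurable hUm).inter
      ((contDiff_adjointCoord B b).continuous.measurable hTm)
  have hfm : Measurable fun x : E => f (Metric.infDist x K) :=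
    hf.comp (Metric.continuous_infDist_pt _).measurable
  rw [← lintegral_indicator hS, lintegral_orthogonal_add hAB hdim b (hfm.indicator hS)]
  have h1 : ∀ y z, (orthogonalCylinder A B b U T).indicator (fun x => f (Metric.infDist x K))
      (b + (A y + B z)) = U.indicator 1 y * T.indicator (fun z => f ‖z‖) z := by
    intro y z
    by_cases hy : y ∈ U
    · by_cases hz : z ∈ T
      · rw [Set.indicator_of_mem, Set.indicator_of_mem hy, Set.indicator_of_mem hz,
          infDist_orthogonal_add hAB hK (hU y hy), Pi.one_apply, one_mul]
        simp only [orthogonalCylinder, Set.mem_ofPred_eq, adjointCoord_add_left hAB,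
          adjointCoord_add_right hAB]
        exact ⟨hy, hz⟩
      · rw [Set.indicator_of_notMem, Set.indicator_of_notMem hz, mul_zero]
        simp only [orthogonalCylinder, Set.mem_ofPred_eq, adjointCoord_add_left hAB,
          adjointCoord_add_right hAB]
        exact fun h => hz h.2
    · rw [Set.indicator_of_notMem, Set.indicator_of_notMem hy, zero_mul]
      simp only [orthogonalCylinder, Set.mem_ofPred_eq, adjointCoord_add_left hAB,
        adjointCoord_add_right hAB]
      exact fun h => hy h.1
  have hg : Measurable (T.indicator fun z => f ‖z‖) := (hf.comp measurable_norm).indicator hTm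
  simp_rw [h1]
  calc ∫⁻ y, ∫⁻ z, U.indicator 1 y * T.indicator (fun z => f ‖z‖) z
      = ∫⁻ y, U.indicator 1 y * ∫⁻ z, T.indicator (fun z => f ‖z‖) z :=
        lintegral_congr fun y => lintegral_const_mul _ hg
    _ = volume U * ∫⁻ z in T, f ‖z‖ := by
        rw [lintegral_mul_const _ (measurable_one.indicator hUm), lintegral_indicator_one hUm,
          lintegral_indicator hTm]

end Cylinders

/-! ### Test functions for the upper bound. -/

section Sharpness

/-- An `L^p` function dominated by the sum of a multiple of one function and a second function of
comparably small norm. -/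
theorem lintegral_rpow_le_of_le_add {X : Type*} [MeasurableSpace X] {μ : Measure X} {p : ℝ}
    (hp : 1 ≤ p) {f F₁ F₂ : X → ℝ≥0∞} (h₁ : AEMeasurable F₁ μ) (h₂ : AEMeasurable F₂ μ)
    {M : ℝ≥0∞} {a ε : ℝ} (ha : 0 ≤ a) (hε : 0 ≤ ε)
    (hf : ∀ᵐ x ∂μ, f x ≤ (F₁ x + F₂ x) ^ p)
    (hF₁ : ∫⁻ x, F₁ x ^ p ∂μ ≤ ENNReal.ofReal (a ^ p) * M)
    (hF₂ : ∫⁻ x, F₂ x ^ p ∂μ ≤ ENNReal.ofReal (ε ^ p) * M) :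
    ∫⁻ x, f x ∂μ ≤ ENNReal.ofReal ((a + ε) ^ p) * M := by
  have hp0 : 0 < p := zero_lt_one.trans_le hp
  have hroot : ∀ {I : ℝ≥0∞} {t : ℝ}, 0 ≤ t → I ≤ ENNReal.ofReal (t ^ p) * M →
      I ^ (1 / p) ≤ ENNReal.ofReal t * M ^ (1 / p) := by
    intro I t ht hI
    refine (ENNReal.rpow_le_rpow hI (by positivity)).trans_eq ?_
    rw [ENNReal.mul_rpow_of_nonneg _ _ (by positivity), ← ENNReal.ofReal_rpow_of_nonneg ht hp0.le,
      ← ENNReal.rpow_mul, mul_one_div_cancel hp0.ne', ENNReal.rpow_one]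
  have h3 := ENNReal.lintegral_Lp_add_le h₁ h₂ hp
  have h4 : (∫⁻ x, (F₁ + F₂) x ^ p ∂μ) ^ (1 / p) ≤ ENNReal.ofReal (a + ε) * M ^ (1 / p) := by
    rw [ENNReal.ofReal_add ha hε, add_mul]
    exact h3.trans (add_le_add (hroot ha hF₁) (hroot hε hF₂))
  calc ∫⁻ x, f x ∂μ ≤ ∫⁻ x, (F₁ + F₂) x ^ p ∂μ := lintegral_mono_ae hf
    _ = ((∫⁻ x, (F₁ + F₂) x ^ p ∂μ) ^ (1 / p)) ^ p := by
        rw [← ENNReal.rpow_mul, one_div_mul_cancel hp0.ne', ENNReal.rpow_one]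
    _ ≤ (ENNReal.ofReal (a + ε) * M ^ (1 / p)) ^ p := by gcongr
    _ = _ := by
        rw [ENNReal.mul_rpow_of_nonneg _ _ hp0.le, ← ENNReal.rpow_mul,
          one_div_mul_cancel hp0.ne', ENNReal.rpow_one,
          ENNReal.ofReal_rpow_of_nonneg (by positivity) hp0.le]

variable {d : ℕ} {K : Set (EuclideanSpace ℝ (Fin d))}

/-- A gradient bound by a multiple of `φ / d` up to an error supported in `S` yields a bound of the
energy by the mass. -/
theorem hardyEnergy_le_of_norm_fderiv_le {p δ δ' a c Λ : ℝ} (hp : 1 ≤ p) (ha : 0 ≤ a) (hc : 0 ≤ c)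
    (hΛ : 0 ≤ Λ) (hKcl : IsClosed K) {φ : EuclideanSpace ℝ (Fin d) → ℝ} (hφc : Continuous φ)
    (hφnn : ∀ x, 0 ≤ φ x) {S : Set (EuclideanSpace ℝ (Fin d))} (hS : MeasurableSet S)
    (hgrad : ∀ x ∈ Kᶜ, ‖fderiv ℝ φ x‖ ≤ a * ((Metric.infDist x K)⁻¹ * φ x) +
      S.indicator (fun x => c * Metric.infDist x K ^ (-(a + 1))) x)
    (hupp : ∫⁻ x in S, ENNReal.ofReal (weight δ δ' (Metric.infDist x K) *
      Metric.infDist x K ^ (-((a + 1) * p))) ≤ ENNReal.ofReal Λ * hardyMass p δ δ' Kᶜ φ) :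
    hardyEnergy p δ δ' Kᶜ φ ≤
      ENNReal.ofReal ((a + c * Λ ^ (1 / p)) ^ p) * hardyMass p δ δ' Kᶜ φ := by
  have hp0 : 0 < p := zero_lt_one.trans_le hp
  have hDm : Measurable fun x : EuclideanSpace ℝ (Fin d) => Metric.infDist x K :=
    (Metric.continuous_infDist_pt _).measurable
  have hwm := (measurable_weight δ δ').comp hDm
  have hKm : MeasurableSet Kᶜ := hKcl.isOpen_compl.measurableSet
  -- The p-th root of the weight is moved inside each summand, so that the unweighted triangle
  -- inequality in L^p applies.
  let F₁ : EuclideanSpace ℝ (Fin d) → ℝ≥0∞ := fun x => ENNReal.ofReal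
    (weight δ δ' (Metric.infDist x K) ^ (1 / p) * (a * ((Metric.infDist x K)⁻¹ * φ x)))
  let F₂ : EuclideanSpace ℝ (Fin d) → ℝ≥0∞ := S.indicator fun x => ENNReal.ofReal
    (weight δ δ' (Metric.infDist x K) ^ (1 / p) * (c * Metric.infDist x K ^ (-(a + 1))))
  have hwroot : ∀ x, (weight δ δ' (Metric.infDist x K) ^ (1 / p)) ^ p =
      weight δ δ' (Metric.infDist x K) := fun x => by
    rw [← Real.rpow_mul (weight_nonneg _ _ Metric.infDist_nonneg), one_div_mul_cancel hp0.ne',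
      Real.rpow_one]
  have hw0 : ∀ x, 0 ≤ weight δ δ' (Metric.infDist x K) := fun x =>
    weight_nonneg _ _ Metric.infDist_nonneg
  have hF₁m : Measurable F₁ := ((hwm.pow_const _).mul
    ((hDm.inv.mul hφc.measurable).const_mul _)).ennreal_ofReal
  have hF₂m : Measurable F₂ := by
    refine Measurable.indicator ?_ hS
    exact ((hwm.pow_const _).mul ((hDm.pow_const _).const_mul _)).ennreal_ofReal
  refine lintegral_rpow_le_of_le_add hp hF₁m.aemeasurable hF₂m.aemeasurable ha
    (ε := c * Λ ^ (1 / p)) (by positivity) ?_ ?_ ?_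
  · rw [ae_restrict_iff' hKm]
    refine ae_of_all _ fun x hx => ?_
    rw [bdryDist_compl, norm_gradient_eq_norm_fderiv]
    have hi0 : 0 ≤ S.indicator (fun x => c * Metric.infDist x K ^ (-(a + 1))) x :=
      Set.indicator_nonneg (fun x _ => mul_nonneg (by positivity)
        (Real.rpow_nonneg Metric.infDist_nonneg _)) x
    have h0 : 0 ≤ a * ((Metric.infDist x K)⁻¹ * φ x) :=
      mul_nonneg ha (mul_nonneg (inv_nonneg.2 Metric.infDist_nonneg) (hφnn x))
    have hw1 := Real.rpow_nonneg (hw0 x) (1 / p)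
    have hsum : F₁ x + F₂ x = ENNReal.ofReal (weight δ δ' (Metric.infDist x K) ^ (1 / p) *
        (a * ((Metric.infDist x K)⁻¹ * φ x) +
          S.indicator (fun x => c * Metric.infDist x K ^ (-(a + 1))) x)) := by
      rw [mul_add, ENNReal.ofReal_add (mul_nonneg hw1 h0) (mul_nonneg hw1 hi0)]
      congr 1
      by_cases hxS : x ∈ S
      · simp only [F₂]
        rw [Set.indicator_of_mem hxS, Set.indicator_of_mem hxS]
      · simp only [F₂]
        rw [Set.indicator_of_notMem hxS, Set.indicator_of_notMem hxS]
        simp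
    rw [hsum, ENNReal.ofReal_rpow_of_nonneg (mul_nonneg hw1 (add_nonneg h0 hi0)) hp0.le,
      Real.mul_rpow hw1 (add_nonneg h0 hi0), hwroot]
    refine ENNReal.ofReal_le_ofReal (mul_le_mul_of_nonneg_left ?_ (hw0 x))
    exact Real.rpow_le_rpow (norm_nonneg _) (hgrad x hx) hp0.le
  · unfold hardyMass
    rw [← lintegral_const_mul' _ _ ENNReal.ofReal_ne_top]
    refine lintegral_mono fun x => le_of_eq ?_
    have hd := Metric.infDist_nonneg (x := x) (s := K)
    simp only [F₁]
    rw [ENNReal.ofReal_rpow_of_nonneg (mul_nonneg (Real.rpow_nonneg (hw0 x) _)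
      (mul_nonneg ha (mul_nonneg (inv_nonneg.2 hd) (hφnn x)))) hp0.le,
      Real.mul_rpow (Real.rpow_nonneg (hw0 x) _)
      (mul_nonneg ha (mul_nonneg (inv_nonneg.2 hd) (hφnn x))), hwroot,
      Real.mul_rpow ha (mul_nonneg (inv_nonneg.2 hd) (hφnn x)),
      Real.mul_rpow (inv_nonneg.2 hd) (hφnn x), ← ENNReal.ofReal_mul (by positivity),
      bdryDist_compl, abs_of_nonneg (hφnn x), Real.rpow_neg hd, Real.inv_rpow hd]
    congr 1
    ring
  · have hF₂p : ∀ x, F₂ x ^ p = S.indicator (fun x => ENNReal.ofReal ((c) ^ p) *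
        ENNReal.ofReal (weight δ δ' (Metric.infDist x K) *
          Metric.infDist x K ^ (-((a + 1) * p)))) x := by
      intro x
      have hd := Metric.infDist_nonneg (x := x) (s := K)
      simp only [F₂]
      by_cases hxS : x ∈ S
      · rw [Set.indicator_of_mem hxS, Set.indicator_of_mem hxS,
          ENNReal.ofReal_rpow_of_nonneg (mul_nonneg (Real.rpow_nonneg (hw0 x) _)
            (mul_nonneg (by positivity) (Real.rpow_nonneg hd _))) hp0.le,
          Real.mul_rpow (Real.rpow_nonneg (hw0 x) _)
            (mul_nonneg (by positivity) (Real.rpow_nonneg hd _)), hwroot,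
          Real.mul_rpow (by positivity) (Real.rpow_nonneg hd _), ← Real.rpow_mul hd,
          ← ENNReal.ofReal_mul (by positivity), neg_mul]
        congr 1
        ring
      · rw [Set.indicator_of_notMem hxS, Set.indicator_of_notMem hxS, ENNReal.zero_rpow_of_pos hp0]
    simp_rw [hF₂p]
    refine (setLIntegral_le_lintegral _ _).trans ?_
    rw [lintegral_indicator hS, lintegral_const_mul' _ _ ENNReal.ofReal_ne_top]
    refine (mul_le_mul_right hupp _).trans_eq ?_
    rw [← mul_assoc, ← ENNReal.ofReal_mul (by positivity)]
    congr 2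
    rw [Real.mul_rpow (by positivity) (by positivity), ← Real.rpow_mul hΛ,
      one_div_mul_cancel hp0.ne', Real.rpow_one]

variable {Y Z : Type*}
  [NormedAddCommGroup Y] [InnerProductSpace ℝ Y] [FiniteDimensional ℝ Y]
  [MeasurableSpace Y] [BorelSpace Y]
  [NormedAddCommGroup Z] [InnerProductSpace ℝ Z] [FiniteDimensional ℝ Z]
  [MeasurableSpace Z] [BorelSpace Z]

/-- If `K` contains arbitrarily large balls of the affine subspace `b + A Y`, and the weight is
comparable with `s ^ m` on long logarithmic intervals, then there are test functions whose Hardy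
quotients are arbitrarily close to `((dim Z + m - p) / p) ^ p`. -/
theorem exists_testFunction_hardyEnergy_le {p δ δ' m κ β : ℝ} (hp : 1 ≤ p) (hκ : 0 < κ)
    (hβ : β ≤ 0) (hZ : 0 < Module.finrank ℝ Z)
    (hpos : 0 < (Module.finrank ℝ Z : ℝ) + m - p)
    (hw : ∀ N s : ℝ, 0 < N → Real.exp (β * N) ≤ s → s ≤ Real.exp ((β + 3) * N) →
      weight δ δ' s ∈ Set.Icc (κ⁻¹ * s ^ m) (κ * s ^ m))
    {A : Y →ₗᵢ[ℝ] EuclideanSpace ℝ (Fin d)} {B : Z →ₗᵢ[ℝ] EuclideanSpace ℝ (Fin d)}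
    (hAB : ∀ y z, inner ℝ (A y) (B z) = 0)
    (hdim : Module.finrank ℝ Y + Module.finrank ℝ Z = d) (b : EuclideanSpace ℝ (Fin d))
    (hKcl : IsClosed K) (hne : K.Nonempty) (hK : ∀ x ∈ K, ∃ y, x = b + A y)
    (hballs : ∀ r > 0, ∃ y₀ : Y, ∀ y ∈ Metric.closedBall y₀ r, b + A y ∈ K) :
    ∃ C : ℝ, 0 ≤ C ∧ ∀ N : ℝ, 0 < N → ∃ φ ∈ testFunctions Kᶜ, φ ≠ 0 ∧
      hardyEnergy p δ δ' Kᶜ φ ≤ ENNReal.ofReal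
        (((Module.finrank ℝ Z + m - p) / p + C / N) ^ p) * hardyMass p δ δ' Kᶜ φ := by
  have hp0 : 0 < p := zero_lt_one.trans_le hp
  set n : ℝ := (Module.finrank ℝ Z : ℝ) with hn
  set a := (n + m - p) / p with ha
  have ha0 : 0 < a := div_pos hpos hp0
  have hap : (a + 1) * p = n + m := by
    rw [ha]
    field_simp
    ring
  have hdim' : Module.finrank ℝ Y + Module.finrank ℝ Z
      = Module.finrank ℝ (EuclideanSpace ℝ (Fin d)) := by simpa using hdim
  obtain ⟨C₁, hC₁, hcutY⟩ := exists_cutoff Y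
  obtain ⟨C₂, hC₂, hcutR⟩ := exists_cutoff ℝ
  -- `H` is 1 on [β + 3/4, β + 9/4], which contains [β + 1, β + 2], and vanishes outside [β, β + 3].
  obtain ⟨H, hHd, hH0, hH1, hHone, hHout, hHdout, hHb⟩ :=
    hcutR (β + 3 / 2) (3 / 4) (by norm_num)
  set C₃ := C₁ + C₂ / (3 / 4) with hC₃
  have hC₃0 : 0 ≤ C₃ := by positivity
  -- Ratio of the error integral to the mass: κ for each of the two weight comparisons, 2^(dim Y)
  -- for doubling the ball, 3 for the shells.
  set Λ : ℝ := κ ^ 2 * (2 ^ Module.finrank ℝ Y * 3) with hΛ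
  have hΛ0 : 0 < Λ := by positivity
  refine ⟨C₃ * Λ ^ (1 / p), by positivity, fun N hN => ?_⟩
  -- On the support ‖z‖ ≤ exp(3N), because β ≤ 0; with this radius ‖z‖ |∇u| ≤ C₁/N, so the
  -- tangential cutoff costs no more than the radial one.
  set ρ := N * Real.exp (3 * N) with hρ
  have hρ0 : 0 < ρ := by positivity
  -- The doubled ball contains the support of `u`, so the distance is ‖z‖ on the whole support of
  -- the test function.
  obtain ⟨y₀, hy₀⟩ := hballs (2 * ρ) (by positivity)
  obtain ⟨u, hud, hu0, hu1, huone, huout, hudout, hub⟩ := hcutY y₀ ρ hρ0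
  have hτ : ∀ τ, τ ∉ Metric.closedBall (β + 3 / 2) (2 * (3 / 4)) ↔ τ < β ∨ β + 3 < τ := by
    intro τ
    rw [Metric.mem_closedBall, Real.dist_eq, abs_le, not_and_or, not_le, not_le]
    constructor <;> rintro (h | h) <;> [left; right; left; right] <;> linarith
  have hHlt : ∀ τ < β, H τ = 0 := fun τ h => hHout τ ((hτ τ).2 (Or.inl h))
  set v : Z → ℝ := radialPower a N H with hv
  have hvd : ContDiff ℝ 1 v := contDiff_radialPower ha0 hN hHd hHlt
  set U₁ := Metric.closedBall y₀ ρ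
  set U₂ := Metric.closedBall y₀ (2 * ρ)
  have hUsub : U₁ ⊆ U₂ := Metric.closedBall_subset_closedBall (by linarith)
  set T₁ := logShell Z ((β + 1) * N) ((β + 2) * N) with hT₁
  set T₂ := logShell Z (β * N) ((β + 3) * N) with hT₂
  have hTsub : T₁ ⊆ T₂ := fun z hz =>
    ⟨(Real.exp_le_exp.2 (by nlinarith)).trans hz.1, hz.2.trans (Real.exp_le_exp.2 (by nlinarith))⟩
  have hT₂pos : ∀ z ∈ T₂, 0 < ‖z‖ := fun z hz => (Real.exp_pos _).trans_le hz.1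
  have hlogout : ∀ z : Z, z ≠ 0 → z ∉ T₂ →
      Real.log ‖z‖ / N ∉ Metric.closedBall (β + 3 / 2) (2 * (3 / 4)) := by
    intro z hz0 hz
    have hz' : 0 < ‖z‖ := norm_pos_iff.2 hz0
    rw [hτ, div_lt_iff₀ hN, lt_div_iff₀ hN, Real.log_lt_iff_lt_exp hz', Real.lt_log_iff_exp_lt hz']
    rw [hT₂, logShell, Set.mem_ofPred_eq, not_and_or, not_le, not_le] at hz
    exact hz
  have hvout : ∀ z ∉ T₂, v z = 0 := by
    intro z hz
    rcases eq_or_ne z 0 with rfl | hz0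
    · exact radialPower_eq_zero ha0 hN hHlt (by rw [norm_zero]; positivity)
    · rw [hv, radialPower, hHout _ (hlogout z hz0 hz), mul_zero]
  have hvone : ∀ z ∈ T₁, v z = ‖z‖ ^ (-a) := by
    intro z hz
    have hz' := hT₂pos z (hTsub hz)
    have h1 : (β + 1) * N ≤ Real.log ‖z‖ := (Real.le_log_iff_exp_le hz').2 hz.1
    have h2 : Real.log ‖z‖ ≤ (β + 2) * N := (Real.log_le_iff_le_exp hz').2 hz.2
    rw [← le_div_iff₀ hN] at h1
    rw [← div_le_iff₀ hN] at h2
    rw [hv, radialPower, hHone, mul_one]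
    rw [Metric.mem_closedBall, Real.dist_eq, abs_le]
    constructor <;> linarith
  set S₁ := orthogonalCylinder A B b U₁ T₁ with hS₁
  set S₂ := orthogonalCylinder A B b U₂ T₂ with hS₂
  have hS₂c : IsCompact S₂ := isCompact_orthogonalCylinder hAB hdim'
    (isCompact_closedBall _ _) (isCompact_logShell _ _)
  have hS₁c : IsCompact S₁ := isCompact_orthogonalCylinder hAB hdim'
    (isCompact_closedBall _ _) (isCompact_logShell _ _)
  have hdist : ∀ y z, y ∈ U₂ → Metric.infDist (b + (A y + B z)) K = ‖z‖ := fun y z hy =>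
    infDist_orthogonal_add hAB hK (hy₀ y hy) z
  have hmemS : ∀ {U : Set Y} {T : Set Z} (y : Y) (z : Z),
      b + (A y + B z) ∈ orthogonalCylinder A B b U T ↔ y ∈ U ∧ z ∈ T := by
    intro U T y z
    rw [orthogonalCylinder, Set.mem_ofPred_eq, adjointCoord_add_left hAB,
      adjointCoord_add_right hAB]
  have hS₂K : S₂ ⊆ Kᶜ := by
    intro x hx
    obtain ⟨y, z, rfl⟩ := exists_eq_orthogonal_add hAB hdim' b x
    rw [hmemS] at hx
    rw [Set.mem_compl_iff, hKcl.notMem_iff_infDist_pos hne, hdist y z hx.1]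
    exact hT₂pos z hx.2
  have hS₁S₂ : S₁ ⊆ S₂ := fun x hx => ⟨hUsub hx.1, hTsub hx.2⟩
  set φ : EuclideanSpace ℝ (Fin d) → ℝ := fun x => u (adjointCoord A b x) * v (adjointCoord B b x)
    with hφ
  have hφS : ∀ x ∉ S₂, φ x = 0 := by
    intro x hx
    by_cases hy : adjointCoord A b x ∈ U₂
    · have hz : adjointCoord B b x ∉ T₂ := fun hz => hx ⟨hy, hz⟩
      rw [hφ]
      simp only [hvout _ hz, mul_zero]
    · rw [hφ]
      simp only [huout _ hy, zero_mul]
  have hua : ContDiff ℝ 1 fun x => u (adjointCoord A b x) := hud.comp (contDiff_adjointCoord A b)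
  have hva : ContDiff ℝ 1 fun x => v (adjointCoord B b x) := hvd.comp (contDiff_adjointCoord B b)
  have hφd : ContDiff ℝ 1 φ := hua.mul hva
  have hφtest : φ ∈ testFunctions Kᶜ := by
    refine ⟨hφd, HasCompactSupport.intro hS₂c hφS, ?_⟩
    refine (closure_minimal (fun x hx => ?_) hS₂c.isClosed).trans hS₂K
    exact by_contra fun h => hx (hφS x h)
  have hφcoord : ∀ y z, φ (b + (A y + B z)) = u y * v z := fun y z => by
    rw [hφ]
    simp only [adjointCoord_add_left hAB, adjointCoord_add_right hAB]
  have hφ0 : φ ≠ 0 := by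
    have : Nontrivial Z := Module.finrank_pos_iff.1 hZ
    obtain ⟨z, hz⟩ := exists_norm_eq Z (Real.exp_pos ((β + 1) * N)).le
    have hzT : z ∈ T₁ := ⟨hz.ge, hz.le.trans (Real.exp_le_exp.2 (by nlinarith))⟩
    intro h
    have h1 := congrFun h (b + (A y₀ + B z))
    rw [hφcoord, huone y₀ (Metric.mem_closedBall_self hρ0.le), one_mul, hvone z hzT, hz] at h1
    exact (Real.rpow_pos_of_pos (Real.exp_pos _) _).ne' h1
  refine ⟨φ, hφtest, hφ0, ?_⟩
  have hφnn : ∀ x, 0 ≤ φ x := fun x =>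
    mul_nonneg (hu0 _) (mul_nonneg (Real.rpow_nonneg (norm_nonneg _) _) (hH0 _))
  -- Only the derivative of the power itself gives the main term a φ/d_Γ. Both cutoff derivatives go
  -- into the error, of size (C₃/N) d_Γ^(-(a+1)) on the support.
  have hgrad : ∀ x ∈ Kᶜ, ‖fderiv ℝ φ x‖ ≤ a * ((Metric.infDist x K)⁻¹ * φ x) +
      S₂.indicator (fun x => C₃ / N * Metric.infDist x K ^ (-(a + 1))) x := by
    intro x hx
    have hd0 := (hKcl.notMem_iff_infDist_pos hne).1 hx
    have hleib : ‖fderiv ℝ φ x‖ ≤ u (adjointCoord A b x) * ‖fderiv ℝ v (adjointCoord B b x)‖ +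
        v (adjointCoord B b x) * ‖fderiv ℝ u (adjointCoord A b x)‖ := by
      have hv0 : 0 ≤ v (adjointCoord B b x) :=
        mul_nonneg (Real.rpow_nonneg (norm_nonneg _) _) (hH0 _)
      have h1 := (((hua.differentiable one_ne_zero x).hasFDerivAt).mul
        ((hva.differentiable one_ne_zero x).hasFDerivAt)).fderiv
      change fderiv ℝ φ x = _ at h1
      rw [h1]
      refine (norm_add_le _ _).trans ?_
      rw [norm_smul, norm_smul, Real.norm_of_nonneg (hu0 _), Real.norm_of_nonneg hv0]
      gcongr
      · exact hu0 _
      · exact norm_fderiv_comp_adjointCoord_le B b hvd x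
      · exact norm_fderiv_comp_adjointCoord_le A b hud x
    obtain ⟨y, z, rfl⟩ := exists_eq_orthogonal_add hAB hdim' b x
    rw [adjointCoord_add_left hAB, adjointCoord_add_right hAB] at hleib
    have hrhs1 : 0 ≤ a * ((Metric.infDist (b + (A y + B z)) K)⁻¹ * φ (b + (A y + B z))) := by
      have := hφnn (b + (A y + B z))
      positivity
    by_cases hy : y ∈ U₂
    · rw [hdist y z hy] at hd0
      have hz0 : z ≠ 0 := norm_pos_iff.1 hd0
      have hDv := norm_fderiv_radialPower_le ha0 hN hHd hH0 hz0
      rw [← hv] at hDv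
      by_cases hz : z ∈ T₂
      · rw [Set.indicator_of_mem ((hmemS y z).2 ⟨hy, hz⟩), hdist y z hy, hφcoord]
        set s := ‖z‖ with hs
        set h := H (Real.log s / N) with hh
        have hh0 : 0 ≤ h := hH0 _
        have hh1 : h ≤ 1 := hH1 _
        have hDH : |deriv H (Real.log s / N)| ≤ C₂ / (3 / 4) := by
          rw [← Real.norm_eq_abs, norm_deriv_eq_norm_fderiv]
          exact hHb _
        have hvz : v z = s ^ (-a) * h := rfl
        have hsa : s ^ (-(a + 1)) = s ^ (-a - 1) := by congr 1; ring
        have hsa' : s ^ (-a) = s ^ (-a - 1) * s := by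
          rw [← Real.rpow_add_one hd0.ne']
          congr 1
          ring
        have hS0 : 0 < s ^ (-a - 1) := Real.rpow_pos_of_pos hd0 _
        have hsle : s * (C₁ / ρ) ≤ C₁ / N := by
          have h3 : s ≤ Real.exp (3 * N) := hz.2.trans (Real.exp_le_exp.2 (by nlinarith))
          calc s * (C₁ / ρ) ≤ Real.exp (3 * N) * (C₁ / ρ) := by gcongr
            _ = C₁ / N := by
              rw [hρ]
              field_simp
        calc ‖fderiv ℝ φ (b + (A y + B z))‖
            ≤ u y * (s ^ (-a - 1) * (a * h + |deriv H (Real.log s / N)| / N)) +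
                v z * (C₁ / ρ) := by
              refine hleib.trans ?_
              gcongr
              · exact hu0 y
              · rw [hvz]; positivity
              · exact hub y
          _ ≤ u y * (s ^ (-a - 1) * (a * h)) + 1 * (s ^ (-a - 1) * (C₂ / (3 / 4) / N)) +
                s ^ (-a - 1) * (1 * (C₁ / N)) := by
              rw [mul_add (s ^ (-a - 1)), mul_add (u y), hvz, hsa']
              have h4 : u y * (s ^ (-a - 1) * (|deriv H (Real.log s / N)| / N)) ≤
                  1 * (s ^ (-a - 1) * (C₂ / (3 / 4) / N)) := by
                gcongr
                exact hu1 y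
              have h5 : s ^ (-a - 1) * s * h * (C₁ / ρ) ≤ s ^ (-a - 1) * (1 * (C₁ / N)) := by
                calc s ^ (-a - 1) * s * h * (C₁ / ρ) = s ^ (-a - 1) * (h * (s * (C₁ / ρ))) := by
                      ring
                  _ ≤ _ := by gcongr
              linarith
          _ = a * (s⁻¹ * (u y * v z)) + C₃ / N * s ^ (-(a + 1)) := by
              rw [hvz, hsa, hsa', hC₃]
              field_simp
              ring
      · have hτz := hlogout z hz0 hz
        have hDH : deriv H (Real.log ‖z‖ / N) = 0 := by
          rw [← fderiv_apply_one_eq_deriv, hHdout _ hτz]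
          rfl
        rw [hHout _ hτz, hDH] at hDv
        have hDv0 : ‖fderiv ℝ v z‖ ≤ 0 := by simpa using hDv
        rw [hvout z hz, zero_mul, add_zero] at hleib
        rw [Set.indicator_of_notMem (fun h => hz ((hmemS y z).1 h).2), add_zero]
        exact (hleib.trans (mul_nonpos_of_nonneg_of_nonpos (hu0 y) hDv0)).trans hrhs1
    · rw [huout y hy, hudout y hy, norm_zero, zero_mul, mul_zero, add_zero] at hleib
      rw [Set.indicator_of_notMem (fun h => hy ((hmemS y z).1 h).1), add_zero]
      exact hleib.trans hrhs1
  set J := ∫⁻ z in T₁, ENNReal.ofReal (‖z‖ ^ (-n)) with hJ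
  -- Where both cutoffs equal 1, φ = d_Γ^(-a), and the integrand c_Ω d_Γ^(-p-ap) is at least κ⁻¹
  -- d_Γ^(-n), since (a + 1)p = n + m.
  have hlow : ENNReal.ofReal κ⁻¹ * (volume U₁ * J) ≤ hardyMass p δ δ' Kᶜ φ := by
    have h1 := setLIntegral_orthogonalCylinder_infDist (f := fun s => ENNReal.ofReal (s ^ (-n))) hAB
      hdim' hK (measurableSet_closedBall (x := y₀) (ε := ρ))
      (isCompact_logShell ((β + 1) * N) ((β + 2) * N)).isClosed.measurableSet
      (fun y hy => hy₀ y (hUsub hy)) (by fun_prop)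
    rw [← hJ] at h1
    rw [← h1, ← lintegral_const_mul' _ _ ENNReal.ofReal_ne_top]
    unfold hardyMass
    refine le_trans ?_ (lintegral_mono_set (hS₁S₂.trans hS₂K))
    refine setLIntegral_mono' hS₁c.isClosed.measurableSet fun x hx => ?_
    obtain ⟨y, z, rfl⟩ := exists_eq_orthogonal_add hAB hdim' b x
    obtain ⟨hy, hz⟩ := (hmemS y z).1 hx
    have hzpos := hT₂pos z (hTsub hz)
    rw [bdryDist_compl, hdist y z (hUsub hy), hφcoord, huone y hy, hvone z hz, one_mul,
      ← ENNReal.ofReal_mul (by positivity), abs_of_pos (by positivity), ← Real.rpow_mul hzpos.le,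
      mul_assoc, ← Real.rpow_add hzpos]
    refine ENNReal.ofReal_le_ofReal ?_
    obtain ⟨h2, -⟩ := hw N ‖z‖ hN (hTsub hz).1 (hTsub hz).2
    calc κ⁻¹ * ‖z‖ ^ (-n) = κ⁻¹ * ‖z‖ ^ m * ‖z‖ ^ (-p + -a * p) := by
          rw [mul_assoc, ← Real.rpow_add hzpos]
          congr 2
          linarith
      _ ≤ _ := by gcongr
  have hupp : ∫⁻ x in S₂, ENNReal.ofReal (weight δ δ' (Metric.infDist x K) *
      Metric.infDist x K ^ (-(n + m))) ≤ ENNReal.ofReal Λ * hardyMass p δ δ' Kᶜ φ := by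
    have h1 := setLIntegral_orthogonalCylinder_infDist
      (f := fun s => ENNReal.ofReal (weight δ δ' s * s ^ (-(n + m)))) hAB
      hdim' hK (measurableSet_closedBall (x := y₀) (ε := 2 * ρ))
      (isCompact_logShell (β * N) ((β + 3) * N)).isClosed.measurableSet hy₀
      (((measurable_weight δ δ').mul (by fun_prop)).ennreal_ofReal)
    have h2 : ∫⁻ z in T₂, ENNReal.ofReal (weight δ δ' ‖z‖ * ‖z‖ ^ (-(n + m))) ≤
        ENNReal.ofReal κ * (3 * J) := by
      refine le_trans ?_ (mul_le_mul_right (lintegral_logShell_three_mul_le (Z := Z) β N) _)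
      rw [← lintegral_const_mul' _ _ ENNReal.ofReal_ne_top]
      refine setLIntegral_mono' (isCompact_logShell _ _).isClosed.measurableSet fun z hz => ?_
      have hzpos := hT₂pos z hz
      rw [← ENNReal.ofReal_mul hκ.le]
      refine ENNReal.ofReal_le_ofReal ?_
      obtain ⟨-, h3⟩ := hw N ‖z‖ hN hz.1 hz.2
      calc weight δ δ' ‖z‖ * ‖z‖ ^ (-(n + m)) ≤ κ * ‖z‖ ^ m * ‖z‖ ^ (-(n + m)) := by gcongr
        _ = κ * ‖z‖ ^ (-n) := by
          rw [mul_assoc, ← Real.rpow_add hzpos]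
          congr 2
          ring
    have h3 : volume U₂ = ENNReal.ofReal (2 ^ Module.finrank ℝ Y) * volume U₁ := by
      rw [Measure.addHaar_closedBall volume y₀ (by positivity),
        Measure.addHaar_closedBall volume y₀ hρ0.le, mul_pow, ENNReal.ofReal_mul (by positivity),
        mul_assoc]
    calc _ = volume U₂ * ∫⁻ z in T₂, ENNReal.ofReal (weight δ δ' ‖z‖ * ‖z‖ ^ (-(n + m))) := h1
      _ ≤ (ENNReal.ofReal (2 ^ Module.finrank ℝ Y) * volume U₁) *
            (ENNReal.ofReal κ * (3 * J)) := by
          rw [h3]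
          gcongr
      _ = ENNReal.ofReal Λ * (ENNReal.ofReal κ⁻¹ * (volume U₁ * J)) := by
          have h4 : ENNReal.ofReal Λ * ENNReal.ofReal κ⁻¹ =
              ENNReal.ofReal (2 ^ Module.finrank ℝ Y) * ENNReal.ofReal κ * 3 := by
            rw [show (3 : ℝ≥0∞) = ENNReal.ofReal 3 by simp, ← ENNReal.ofReal_mul hΛ0.le,
              ← ENNReal.ofReal_mul (by positivity), ← ENNReal.ofReal_mul (by positivity)]
            congr 1
            rw [hΛ]
            field_simp
          rw [← mul_assoc (ENNReal.ofReal Λ), h4]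
          ring
      _ ≤ _ := by gcongr
  have hend := hardyEnergy_le_of_norm_fderiv_le hp ha0.le (div_nonneg hC₃0 hN.le) hΛ0.le hKcl
    hφd.continuous hφnn hS₂c.isClosed.measurableSet hgrad (by rwa [hap])
  rwa [← mul_div_right_comm] at hend

end Sharpness

/-- On long logarithmic intervals near the origin or near infinity the weight is comparable with the
power of the smaller exponent. -/
theorem exists_weight_comparison (δ δ' : ℝ) : ∃ β ≤ (0 : ℝ), ∀ N s : ℝ, 0 < N →
    Real.exp (β * N) ≤ s → s ≤ Real.exp ((β + 3) * N) →
    weight δ δ' s ∈ Set.Icc (((2 : ℝ) ^ |δ' - δ|)⁻¹ * s ^ min δ δ')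
      (2 ^ |δ' - δ| * s ^ min δ δ') := by
  rw [← Real.rpow_neg zero_le_two]
  rcases le_total δ δ' with h | h
  -- If δ is the smaller exponent, β = -3 keeps the interval inside (0, 1]; otherwise β = 0 keeps it
  -- inside [1, ∞).
  · refine ⟨-3, by norm_num, fun N s hN h1 h2 => ?_⟩
    rw [min_eq_left h]
    exact weight_mem_Icc_of_le_one δ δ' ((Real.exp_pos _).trans_le h1) (by simpa using h2)
  · refine ⟨0, le_rfl, fun N s hN h1 h2 => ?_⟩
    rw [min_eq_right h]
    exact weight_mem_Icc_of_one_le δ δ' (by simpa using h1)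

/-! ### Assembly of the two bounds. -/

theorem theorem4p5 {d k : ℕ} (hk : 1 ≤ k) (hkd : k ≤ d - 1)
    (K : Set (EuclideanSpace ℝ (Fin d))) (hK_closed : IsClosed K) (hK_convex : Convex ℝ K)
    (hK_dim : affineDim K = k)
    -- an identification of `ℝ^k` with the affine hull of `K`
    (e : EuclideanSpace ℝ (Fin k) →ᵃⁱ[ℝ] EuclideanSpace ℝ (Fin d))
    (he : Set.range e = (affineSpan ℝ K : Set (EuclideanSpace ℝ (Fin d))))
    (hK_inf : dimAtInfinity (e ⁻¹' K) = (k : EReal))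
    (p δ δ' : ℝ) (hp : 1 ≤ p) (hδ : 0 ≤ δ) (hδ' : 0 ≤ δ')
    (hpos : 0 < (d : ℝ) - (k : ℝ) + min δ δ' - p) :
    hardyConstant p δ δ' Kᶜ =
      ENNReal.ofReal ((((d : ℝ) - (k : ℝ) + min δ δ' - p) / p) ^ p) := by
  have hcast : (d : ℝ) - k = (Module.finrank ℝ (EuclideanSpace ℝ (Fin (d - k))) : ℝ) := by
    rw [finrank_euclideanSpace_fin, Nat.cast_sub (by omega)]
  have hdim : Module.finrank ℝ (EuclideanSpace ℝ (Fin k)) +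
      Module.finrank ℝ (EuclideanSpace ℝ (Fin (d - k))) = d := by
    rw [finrank_euclideanSpace_fin, finrank_euclideanSpace_fin]
    omega
  rw [hcast] at hpos ⊢
  have heA : ∀ y, e 0 + e.linearIsometry y = e y := by
    intro y
    have := e.map_vadd 0 y
    rw [vadd_eq_add, vadd_eq_add, add_zero] at this
    rw [this, add_comm]
  have hne : K.Nonempty := by
    have h1 : (affineSpan ℝ K : Set (EuclideanSpace ℝ (Fin d))).Nonempty :=
      he ▸ Set.range_nonempty e
    exact (affineSpan_nonempty ℝ).1 h1
  have hK : ∀ x ∈ K, ∃ y, x = e 0 + e.linearIsometry y := by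
    intro x hx
    obtain ⟨y, rfl⟩ : x ∈ Set.range e := he ▸ subset_affineSpan ℝ K hx
    exact ⟨y, (heA y).symm⟩
  obtain ⟨B, hAB⟩ := exists_orthogonal_linearIsometry (Z := EuclideanSpace ℝ (Fin (d - k)))
    e.linearIsometry (by rw [hdim, finrank_euclideanSpace_fin])
  apply le_antisymm
  · have hballs : ∀ r > 0, ∃ y₀, ∀ y ∈ Metric.closedBall y₀ r, e 0 + e.linearIsometry y ∈ K := by
      intro r hr
      obtain ⟨y₀, hy₀⟩ := exists_closedBall_subset_of_dimAtInfinity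
        (hK_closed.preimage e.continuous) (hK_convex.affine_preimage e.toAffineMap) hk hK_inf r hr
      exact ⟨y₀, fun y hy => by rw [heA]; exact hy₀ hy⟩
    obtain ⟨β, hβ, hw⟩ := exists_weight_comparison δ δ'
    obtain ⟨C, hC, htest⟩ := exists_testFunction_hardyEnergy_le hp (by positivity) hβ
      (by rw [finrank_euclideanSpace_fin]; omega) hpos hw hAB hdim (e 0) hK_closed hne hK hballs
    set a := ((Module.finrank ℝ (EuclideanSpace ℝ (Fin (d - k))) : ℝ) + min δ δ' - p) / p with ha
    have hle : ∀ N : ℝ, 0 < N → hardyConstant p δ δ' Kᶜ ≤ ENNReal.ofReal ((a + C / N) ^ p) := by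
      intro N hN
      obtain ⟨φ, hφ, hφ0, hφle⟩ := htest N hN
      exact (iInf₂_le φ ⟨hφ, hφ0⟩).trans (ENNReal.div_le_of_le_mul hφle)
    -- The infimum lies below every quotient; letting the logarithmic length N tend to infinity
    -- removes the error C/N.
    have hlim : Tendsto (fun N : ℝ => ENNReal.ofReal ((a + C / N) ^ p)) atTop
        (nhds (ENNReal.ofReal (a ^ p))) := by
      refine ENNReal.tendsto_ofReal ?_
      have h1 : Tendsto (fun N : ℝ => a + C / N) atTop (nhds (a + 0)) :=
        tendsto_const_nhds.add (tendsto_const_nhds.div_atTop tendsto_id)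
      rw [add_zero] at h1
      exact h1.rpow_const (Or.inr (zero_le_one.trans hp))
    refine ge_of_tendsto hlim ?_
    filter_upwards [eventually_gt_atTop 0] with N hN
    exact hle N hN
  · refine le_iInf₂ fun φ hφ => ?_
    rw [ENNReal.le_div_iff_mul_le (Or.inl (hardyMass_ne_zero hK_closed hne hφ.1 hφ.2))
      (Or.inl (hardyMass_ne_top hp hK_closed hne hφ.1))]
    exact hardyMass_le_hardyEnergy hp hpos hAB hdim (e 0) hK_closed hK_convex hne hK hφ.1
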